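/- **Setting.** Let $k\ge 0$ and let $m_1,\dots,m_k$ be integers with $m_i>1$. For $1\le i<j\le k$ let $\theta_{ij}$ be a permutation of $\{1,\dots,m_i\}\times\{1,\dots,m_j\}$. Let $\mathbb F_\theta^+$ be the unital semigroup generated by elements $e^i_s$ ($1\le i\le k$, $1\le s\le m_i$) subject to the relations $$e^i_s e^j_t=e^j_{t'}e^i_{s'}\quad\text{whenever } i<j \text{ and } \theta_{ij}(s,t)=(s',t').$$ Assume the cubic condition: for all $i<j<l$, the two ways of using these relations to rewrite a word $e^i_ae^j_be^l_c$ as a word of the form $e^l_{c'}e^j_{b'}e^i_{a'}$ yield the same indices $a',b',c'$. Thus $\mathbb F_\theta^+$ is a single-vertex $k$-graph. Let $d:\mathbb F_\theta^+\to\mathbb N^k$ be the degree homomorphism, which sends $e^i_s$ to the $i$-th standard generator $\varepsilon_i$. We say that $\mathbb F_\theta^+$ has the *little pull-back property* if, for all $e,f\in\mathbb F_\theta^+$ whose degrees are two distinct elements of $\{\varepsilon_1,\dots,\varepsilon_k\}$, there is at most one pair $(\xi,\eta)\in\mathbb F_\theta^+\times\mathbb F_\theta^+$ with $e\xi=f\eta$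 and $d(e\xi)=d(e)\vee d(f)$, where $\vee$ is the coordinatewise maximum. A *Cuntz-type representation* of $\mathbb F_\theta^+$ in a unital C*-algebra consists of elements $E^i_s$ such that $E^i_sE^j_t=E^j_{t'}E^i_{s'}$ whenever $i<j$ and $\theta_{ij}(s,t)=(s',t')$, and such that for every $i$ one has $(E^i_s)^*E^i_t=\delta_{s,t}1$ and $\sum_{s}E^i_s(E^i_s)^*=1$. Let $\mathcal O_\theta$, with generators $s^i_t$, be the universal unital C*-algebra for Cuntz-type representations of $\mathbb F_\theta^+$. For $w=e^{j_1}_{t_1}\cdots e^{j_n}_{t_n}$ put $s_w=s^{j_1}_{t_1}\cdots s^{j_n}_{t_n}$, and let $$\mathcal X_0=\operatorname{span}\{s_us_v^*: u,v\in\mathbb F_\theta^+,\ d(u)=d(v)\}\subseteq\mathcal O_\theta .$$ A unital C*-algebra $\mathcal A$ has the *Dixmier property* if, for every $A\in\mathcal A$, the norm closure of the set of all averages $\sum_{i=1}^n\lambda_iU_iAU_i^*$ ($n\ge1$, $U_i$ unitary in $\mathcal A$, $\lambda_i>0$, $\sum_i\lambda_i=1$) meets the centre of $\mathcal A$. **Corollary.**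 Suppose that $\mathbb F_\theta^+$ has the little pull-back property. Let $\mathcal A$ be a unital C*-subalgebra of $\mathcal O_\theta$ (a norm-closed *-subalgebra containing the unit of $\mathcal O_\theta$) with $\mathcal X_0\subseteq\mathcal A$. Then $\mathcal A$ is simple (it is nonzero and has no two-sided ideals other than $0$ and $\mathcal A$) and has the Dixmier property. -/

import Mathlib

universe u

/-! ### Single-vertex higher-rank graphs -/

/-- The combinatorial data `(m, θ)` of a single-vertex `k`-graph. There are `m i` generators
`e^i_s` of colour `i`. For `i < j` the permutation `θ i j` of `Fin (m i) × Fin (m j)` encodes the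
commutation relations `e^i_s e^j_t = e^j_{t'} e^i_{s'}` where `θ i j (s, t) = (s', t')`.
The field `cubic` says that the two ways of rewriting `e^i_a e^j_b e^l_c` in the opposite order of
colours lead to the same word. -/
structure SingleVertexGraph (k : ℕ) where
  /-- number of generators of each colour -/
  m : Fin k → ℕ
  /-- the commutation permutations -/
  θ : ∀ i j : Fin k, i < j → Equiv.Perm (Fin (m i) × Fin (m j))
  /-- the cubic condition: the first three equations rewrite
  `e^i_a e^j_b e^l_c = e^i_a e^l_{c₁} e^j_{b₁} = e^l_{c₂} e^i_{a₁} e^j_{b₁}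
    = e^l_{c₂} e^j_{b₂} e^i_{a₂}`, the last three rewrite
  `e^i_a e^j_b e^l_c = e^j_{b₃} e^i_{a₃} e^l_c = e^j_{b₃} e^l_{c₃} e^i_{a₄}
    = e^l_{c₄} e^j_{b₄} e^i_{a₄}`. -/
  cubic : ∀ (i j l : Fin k) (hij : i < j) (hjl : j < l)
    (a a₁ a₂ a₃ a₄ : Fin (m i)) (b b₁ b₂ b₃ b₄ : Fin (m j)) (c c₁ c₂ c₃ c₄ : Fin (m l)),
    θ j l hjl (b, c) = (b₁, c₁) →
    θ i l (hij.trans hjl) (a, c₁) = (a₁, c₂) →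
    θ i j hij (a₁, b₁) = (a₂, b₂) →
    θ i j hij (a, b) = (a₃, b₃) →
    θ i l (hij.trans hjl) (a₃, c) = (a₄, c₃) →
    θ j l hjl (b₃, c₃) = (b₄, c₄) →
    a₂ = a₄ ∧ b₂ = b₄ ∧ c₂ = c₄

namespace SingleVertexGraph

variable {k : ℕ} (D : SingleVertexGraph k)

/-- The set of generators: pairs of a colour `i` and an index `s < m i`. -/
abbrev Gen : Type := Σ i : Fin k, Fin (D.m i)

/-- The `θ`-commutation relations between words in the generators. -/
inductive CommRel : FreeMonoid D.Gen → FreeMonoid D.Gen → Prop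
  | swap (i j : Fin k) (hij : i < j) (s : Fin (D.m i)) (t : Fin (D.m j)) :
      CommRel (FreeMonoid.of ⟨i, s⟩ * FreeMonoid.of ⟨j, t⟩)
        (FreeMonoid.of ⟨j, (D.θ i j hij (s, t)).2⟩ * FreeMonoid.of ⟨i, (D.θ i j hij (s, t)).1⟩)

/-- The single-vertex `k`-graph `𝔽_θ⁺`: the unital semigroup generated by the `e^i_s` subject to
the `θ`-commutation relations. -/
abbrev Path : Type := PresentedMonoid D.CommRel

/-- The generator `e^i_s` of `𝔽_θ⁺`. -/
def edge (i : Fin k) (s : Fin (D.m i)) : D.Path := PresentedMonoid.of D.CommRel ⟨i, s⟩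

/-- The degree map as a monoid homomorphism into `ℕ^k`, sending `e^i_s` to the `i`-th standard
generator. -/
def degHom : D.Path →* Multiplicative (Fin k → ℕ) :=
  PresentedMonoid.lift (fun e : D.Gen => Multiplicative.ofAdd (Pi.single e.1 1)) (by
    rintro _ _ ⟨i, j, hij, s, t⟩
    simp only [map_mul, FreeMonoid.lift_eval_of]
    exact mul_comm _ _)

/-- The degree `d(w) ∈ ℕ^k` of a word `w`. -/
def deg (w : D.Path) : Fin k → ℕ := Multiplicative.toAdd (D.degHom w)

/-- The set `Λ^min(μ, ν)` of minimal common extensions. -/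
def minExt (μ ν : D.Path) : Set (D.Path × D.Path) :=
  {p | μ * p.1 = ν * p.2 ∧ D.deg (μ * p.1) = D.deg μ ⊔ D.deg ν}

/-- The little pull-back property: `|Λ^min(e, f)| ≤ 1` for all edges `e`, `f` of distinct
degrees, the edges being the elements whose degree is one of the standard generators. -/
def LittlePullback : Prop :=
  ∀ e f : D.Path, (∃ i, D.deg e = Pi.single i 1) → (∃ j, D.deg f = Pi.single j 1) →
    D.deg e ≠ D.deg f → (D.minExt e f).encard ≤ 1

end SingleVertexGraph

/-! ### Cuntz-type representations and the universal C⋆-algebra -/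

/-- A tuple `(V_1, …, V_n)` is of Cuntz type if `V_i⋆ V_j = δ_{ij}` and `∑ V_i V_i⋆ = 1`. -/
def IsCuntzTuple {A : Type*} [CStarAlgebra A] {n : ℕ} (V : Fin n → A) : Prop :=
  (∀ i j, star (V i) * V j = if i = j then 1 else 0) ∧ ∑ i, V i * star (V i) = 1

namespace SingleVertexGraph

variable {k : ℕ} (D : SingleVertexGraph k)

/-- Cuntz-type representations of `𝔽_θ⁺` in a unital C⋆-algebra `A`: families `E^i_s` satisfying
the `θ`-commutation relations such that every `E^i` is of Cuntz type. -/
structure IsCuntzRep {A : Type*} [CStarAlgebra A] (E : ∀ i : Fin k, Fin (D.m i) → A) : Prop where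
  comm : ∀ (i j : Fin k) (hij : i < j) (s : Fin (D.m i)) (t : Fin (D.m j)),
    E i s * E j t = E j (D.θ i j hij (s, t)).2 * E i (D.θ i j hij (s, t)).1
  cuntz : ∀ i, IsCuntzTuple (E i)

/-- All Cuntz-type representations of `𝔽_θ⁺` in nonzero unital C⋆-algebras (of universe `u`). -/
structure CuntzRep where
  /-- the C⋆-algebra -/
  carrier : Type u
  [cstar : CStarAlgebra carrier]
  [nontrivial : Nontrivial carrier]
  /-- the representing operators -/
  E : ∀ i : Fin k, Fin (D.m i) → carrier
  isRep : D.IsCuntzRep E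

attribute [instance] CuntzRep.cstar CuntzRep.nontrivial

/-- The product (`ℓ^∞`-direct sum) of the C⋆-algebras of all Cuntz-type representations. -/
abbrev RepProd : Type (u + 1) := lp (fun ρ : CuntzRep.{u} D => ρ.carrier) ⊤

noncomputable instance : CStarAlgebra (RepProd.{u} D) where

variable {D} in
theorem IsCuntzRep.norm_le_one {A : Type*} [CStarAlgebra A] {E : ∀ i : Fin k, Fin (D.m i) → A}
    (h : D.IsCuntzRep E) (i : Fin k) (s : Fin (D.m i)) : ‖E i s‖ ≤ 1 := by
  have h1 : star (E i s) * E i s = 1 := by simpa using (h.cuntz i).1 s s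
  have h2 := CStarRing.norm_star_mul_self (x := E i s)
  rw [h1] at h2
  rcases subsingleton_or_nontrivial A with hA | hA
  · simp [Subsingleton.elim (E i s) 0]
  · rw [CStarRing.norm_one] at h2
    nlinarith [norm_nonneg (E i s)]

/-- The direct sum `(ρ(e^i_s))_ρ` over all Cuntz-type representations `ρ`. -/
noncomputable def prodGen (i : Fin k) (s : Fin (D.m i)) : RepProd.{u} D :=
  ⟨fun ρ => ρ.E i s, memℓp_infty ⟨1, by rintro _ ⟨ρ, rfl⟩; exact ρ.isRep.norm_le_one i s⟩⟩

/-- The closed unital star subalgebra generated by the direct sum of all Cuntz-type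
representations. -/
noncomputable def genSubalgebra : StarSubalgebra ℂ (RepProd.{u} D) :=
  (StarAlgebra.adjoin ℂ (Set.range fun e : D.Gen => prodGen.{u} D e.1 e.2)).topologicalClosure

/-- The `k`-graph C⋆-algebra `𝒪_θ`: the universal C⋆-algebra for Cuntz-type representations of
`𝔽_θ⁺`, realised as the C⋆-algebra generated by the direct sum of all such representations.
Its universal property is `existsUnique_lift` below. -/
def CStarAlg : Type (u + 1) := ↥(genSubalgebra.{u} D)

instance : IsClosed (genSubalgebra.{u} D : Set (RepProd.{u} D)) :=
  StarSubalgebra.isClosed_topologicalClosure _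

noncomputable instance : CStarAlgebra (CStarAlg.{u} D) :=
  inferInstanceAs (CStarAlgebra ↥(genSubalgebra.{u} D))

/-- The standard generator `s^i_t` of `𝒪_θ`. -/
noncomputable def gen (i : Fin k) (t : Fin (D.m i)) : CStarAlg.{u} D :=
  (⟨prodGen D i t, StarSubalgebra.le_topologicalClosure _
    (StarAlgebra.subset_adjoin ℂ _ ⟨⟨i, t⟩, rfl⟩)⟩ : ↥(genSubalgebra.{u} D))

theorem isCuntzRep_prodGen : D.IsCuntzRep (prodGen.{u} D) where
  comm i j hij s t := by
    ext ρ
    exact ρ.isRep.comm i j hij s t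
  cuntz i := by
    refine ⟨fun s t => ?_, ?_⟩
    · ext ρ
      have := (ρ.isRep.cuntz i).1 s t
      by_cases hst : s = t
      · rw [if_pos hst] at this ⊢
        exact this
      · rw [if_neg hst] at this ⊢
        exact this
    · ext ρ
      have := (ρ.isRep.cuntz i).2
      rw [lp.coeFn_sum, Finset.sum_apply]
      exact this

theorem isCuntzRep_gen : D.IsCuntzRep (gen.{u} D) where
  comm i j hij s t := Subtype.ext ((isCuntzRep_prodGen D).comm i j hij s t)
  cuntz i := by
    refine ⟨fun s t => Subtype.ext ?_, Subtype.ext ?_⟩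
    · have := ((isCuntzRep_prodGen.{u} D).cuntz i).1 s t
      by_cases hst : s = t
      · rw [if_pos hst] at this ⊢
        exact this
      · rw [if_neg hst] at this ⊢
        exact this
    · have := ((isCuntzRep_prodGen.{u} D).cuntz i).2
      refine Eq.trans ?_ this
      exact map_sum (genSubalgebra.{u} D).subtype _ _

/-- Evaluation of an element of the direct sum at one representation. -/
noncomputable def evalRep (ρ : CuntzRep.{u} D) : RepProd.{u} D →⋆ₐ[ℂ] ρ.carrier where
  toFun x := x ρ
  map_one' := rfl
  map_mul' _ _ := rfl
  map_zero' := rfl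
  map_add' _ _ := rfl
  commutes' _ := rfl
  map_star' _ := rfl

/-- The universal property of `𝒪_θ`: every Cuntz-type representation in a unital C⋆-algebra `B`
extends to a unique unital star homomorphism on `𝒪_θ`. -/
theorem existsUnique_lift {B : Type u} [CStarAlgebra B] (E : ∀ i : Fin k, Fin (D.m i) → B)
    (hE : D.IsCuntzRep E) :
    ∃! φ : CStarAlg.{u} D →⋆ₐ[ℂ] B, ∀ i t, φ (gen.{u} D i t) = E i t := by
  rcases subsingleton_or_nontrivial B with hB | hB
  · refine ⟨⟨⟨⟨⟨⟨fun _ => 0, Subsingleton.elim _ _⟩, fun _ _ => Subsingleton.elim _ _⟩,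
      Subsingleton.elim _ _, fun _ _ => Subsingleton.elim _ _⟩, fun _ => Subsingleton.elim _ _⟩,
      fun _ => Subsingleton.elim _ _⟩, fun _ _ => Subsingleton.elim _ _, fun ψ _ => ?_⟩
    ext x
    exact Subsingleton.elim _ _
  · let ρ : CuntzRep.{u} D := { carrier := B, E := E, isRep := hE }
    let φ : CStarAlg.{u} D →⋆ₐ[ℂ] B := (evalRep D ρ).comp (genSubalgebra.{u} D).subtype
    have hφ : ∀ i t, φ (gen.{u} D i t) = E i t := fun i t => rfl
    refine ⟨φ, hφ, fun ψ hψ => ?_⟩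
    have hcφ : Continuous φ := (NonUnitalStarAlgHom.instContinuousLinearMapClassComplex
      (F := CStarAlg.{u} D →⋆ₐ[ℂ] B)).map_continuous φ
    have hcψ : Continuous ψ := (NonUnitalStarAlgHom.instContinuousLinearMapClassComplex
      (F := CStarAlg.{u} D →⋆ₐ[ℂ] B)).map_continuous ψ
    refine StarAlgHom.ext_topologicalClosure
      (S := StarAlgebra.adjoin ℂ (Set.range fun e : D.Gen => prodGen.{u} D e.1 e.2))
      (φ := ψ) (ψ := φ) hcψ hcφ ?_
    refine StarAlgHom.ext_adjoin ?_
    rintro ⟨_, hx⟩ ⟨e, rfl⟩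
    exact (hψ e.1 e.2).trans (hφ e.1 e.2).symm

/-- The elements `s_w`, `w ∈ 𝔽_θ⁺`: the monoid homomorphism with `e^i_t ↦ s^i_t`. -/
noncomputable def wordOp : D.Path →* CStarAlg.{u} D :=
  PresentedMonoid.lift (fun e : D.Gen => gen.{u} D e.1 e.2) (by
    rintro _ _ ⟨i, j, hij, s, t⟩
    simp only [map_mul, FreeMonoid.lift_eval_of]
    exact (isCuntzRep_gen D).comm i j hij s t)

/-- `𝒳_n = span {s_u s_v⋆ : d(u) - d(v) = n}` for `n ∈ ℤ^k`. -/
noncomputable def algSpectral (n : Fin k → ℤ) : Submodule ℂ (CStarAlg.{u} D) :=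
  Submodule.span ℂ {x | ∃ w z : D.Path,
    (∀ i, (D.deg w i : ℤ) - (D.deg z i : ℤ) = n i) ∧
      x = wordOp.{u} D w * star (wordOp.{u} D z)}

end SingleVertexGraph

/-! ### The Dixmier property -/

/-- The averaging operators `a ↦ ∑ λ_i U_i a U_i⋆` with `U_i` in a group `V` of unitaries,
`λ_i > 0` and `∑ λ_i = 1`. -/
def averagingOperators (A : Type*) [CStarAlgebra A] (V : Subgroup (unitary A)) : Set (A → A) :=
  {α | ∃ (n : ℕ) (U : Fin n → unitary A) (c : Fin n → ℝ),
    (∀ i, U i ∈ V) ∧ (∀ i, 0 < c i) ∧ ∑ i, c i = 1 ∧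
      ∀ a, α a = ∑ i, (c i : ℂ) • ((U i : A) * a * star (U i : A))}

/-- The Dixmier property: for every `a`, the norm closure of `{α(a) : α ∈ Ave(A, U(A))}` meets the
centre of `A`. -/
def HasDixmierProperty (A : Type*) [CStarAlgebra A] : Prop :=
  ∀ a : A, (closure {b | ∃ α ∈ averagingOperators A ⊤, b = α a} ∩ Set.center A).Nonempty

namespace SingleVertexGraph

variable {k : ℕ} {D : SingleVertexGraph k}

/-! ### Factorisations in `𝔽_θ⁺` -/

/-! The argument rests on the commuting unital contractions `avg D i`, that is, x ↦ m_i⁻¹ ∑ₛ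
(s^i_s)⋆ x s^i_s. Applied to s_u s_v⋆ with d(u) = d(v), they strip the edges of u and v in pairs and
end at a scalar. If the degrees of u and v differ in colour i, powers of `avg D i` tend to zero on
s_u s_v⋆: once one of the words has no edge of colour i left, the pull-back property, in the form
`star_gen_mul_gen_of_lt`, makes each further application produce at most one term, so that a factor
m_i⁻¹ is gained every time (`norm_avg_pow_le`). By density every x is carried arbitrarily close to a
scalar (`exists_avg_norm_sub_smul_one_lt`).

These maps are not unitary averages inside 𝒜. A product of them has the form x ↦ n⁻¹ ∑ₐ V_a⋆ x V_a,
where the V_a are the operators of words of one degree and form a tuple of Cuntz type. Following it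
by the endomorphism y ↦ ∑_b V_b y V_b⋆, which fixes scalars and is contractive, gives n⁻¹ ∑ (V_b
V_a⋆) x (V_a V_b⋆). Only the degree-zero matrix units V_b V_a⋆ ∈ 𝒳₀ occur here, and this is a
uniform average over signed permutation matrices (`IsMatrixUnits.mem_averagingOperators`).
Compactness of bounded sets of scalars then yields the Dixmier property.

For simplicity, let a ≠ 0 lie in an ideal and put f = a⋆a. Integrating the gauge action over the
torus is faithful on positive elements, so f has a nonzero degree-zero part. That part is close to a
matrix over words of a single degree, and compressing by suitable vectors w, v of norm at most one
turns it into a scalar μ 1 (`IsCuntzTuple.exists_lt_norm`). Averaging makes the remaining degrees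
small, and the same endomorphism trick keeps all multipliers in 𝒳₀. The ideal then contains an
element at distance less than |μ| from μ 1, which is invertible.

That 𝒪_θ is nonzero needs a concrete representation. It acts on ℓ² of formal fractions w τ⁻ⁿ and
relies on left cancellation in 𝔽_θ⁺, which is where the cubic condition enters. -/

theorem edge_mul_edge {i j : Fin k} (hij : i < j) (s : Fin (D.m i)) (t : Fin (D.m j)) :
    D.edge i s * D.edge j t
      = D.edge j (D.θ i j hij (s, t)).2 * D.edge i (D.θ i j hij (s, t)).1 := by
  have := PresentedMonoid.mk_eq_mk_of_rel (CommRel.swap (D := D) i j hij s t)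
  rw [map_mul, map_mul] at this
  exact this

@[elab_as_elim]
theorem path_induction {P : D.Path → Prop} (one : P 1)
    (edge_mul : ∀ i s w, P w → P (D.edge i s * w)) (w : D.Path) : P w := by
  induction w using PresentedMonoid.inductionOn with | _ a
  induction a using FreeMonoid.recOn with
  | one => exact one
  | of_mul x a ih =>
    rw [map_mul]
    exact edge_mul x.1 x.2 _ ih

theorem deg_one : D.deg 1 = 0 := by
  unfold deg; rw [map_one]; rfl

theorem deg_mul (v w : D.Path) : D.deg (v * w) = D.deg v + D.deg w := by
  unfold deg; rw [map_mul]; rfl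

theorem deg_edge (i : Fin k) (s : Fin (D.m i)) : D.deg (D.edge i s) = Pi.single i 1 := rfl

theorem deg_edge_mul_self (i : Fin k) (s : Fin (D.m i)) (w : D.Path) :
    D.deg (D.edge i s * w) i = D.deg w i + 1 := by
  rw [deg_mul, deg_edge, Pi.add_apply, Pi.single_eq_same, add_comm]

theorem deg_edge_mul_of_ne {i j : Fin k} (h : j ≠ i) (s : Fin (D.m i)) (w : D.Path) :
    D.deg (D.edge i s * w) j = D.deg w j := by
  rw [deg_mul, deg_edge, Pi.add_apply, Pi.single_eq_of_ne h, zero_add]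

variable (D) in
/-- `comm i j t s = (s', t')` encodes the relation `e^j_t e^i_s = e^i_{s'} e^j_{t'}`, for colours
`i ≠ j` in either order. -/
def comm (i j : Fin k) (t : Fin (D.m j)) (s : Fin (D.m i)) : Fin (D.m i) × Fin (D.m j) :=
  if h : j < i then (D.θ j i h (t, s)).swap
  else if h : i < j then (D.θ i j h).symm (s, t) else (s, t)

theorem edge_mul_edge_comm {i j : Fin k} (hij : i ≠ j) (t : Fin (D.m j)) (s : Fin (D.m i)) :
    D.edge j t * D.edge i s = D.edge i (D.comm i j t s).1 * D.edge j (D.comm i j t s).2 := by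
  unfold comm
  rcases lt_or_gt_of_ne hij with h | h
  · rw [dif_neg h.not_gt, dif_pos h, edge_mul_edge h, Prod.mk.eta, Equiv.apply_symm_apply]
  · rw [dif_pos h, edge_mul_edge h]; rfl

theorem exists_eq_edge_mul {i : Fin k} {w : D.Path} (h : D.deg w i ≠ 0) :
    ∃ s w', w = D.edge i s * w' := by
  induction w using path_induction with
  | one => simp [deg_one] at h
  | edge_mul j t w ih =>
    by_cases hij : i = j
    · subst hij; exact ⟨t, w, rfl⟩
    · rw [deg_edge_mul_of_ne hij] at h
      obtain ⟨s, w', rfl⟩ := ih h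
      exact ⟨_, _, by rw [← mul_assoc, edge_mul_edge_comm hij, mul_assoc]⟩

variable (D) in
/-- The action of a generator on pairs `(w, o)`, where `o` is thought of as the factorisation
of `w` with an edge of colour `i` in front. -/
def factorStep (i : Fin k) (e : D.Gen) :
    Function.End (D.Path × Option (Fin (D.m i) × D.Path)) := fun x =>
  (D.edge e.1 e.2 * x.1,
    if h : e.1 = i then some (h ▸ e.2, x.1)
    else x.2.map fun y => ((D.comm i e.1 e.2 y.1).1, D.edge e.1 (D.comm i e.1 e.2 y.1).2 * y.2))

/-- This is the cubic condition for the sorted triple formed by a, b and i. If i is the largest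
colour it applies directly; otherwise some of the rewritings run backwards, and injectivity of the
permutations identifies the remaining indices. -/
theorem comm_comm {i a b : Fin k} (hab : a < b) (hai : a ≠ i) (hbi : b ≠ i)
    (p : Fin (D.m a)) (q : Fin (D.m b)) (s : Fin (D.m i)) :
    (D.comm i a p (D.comm i b q s).1).1
      = (D.comm i b (D.θ a b hab (p, q)).2 (D.comm i a (D.θ a b hab (p, q)).1 s).1).1 ∧
    D.θ a b hab ((D.comm i a p (D.comm i b q s).1).2, (D.comm i b q s).2)
      = ((D.comm i a (D.θ a b hab (p, q)).1 s).2,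
        (D.comm i b (D.θ a b hab (p, q)).2 (D.comm i a (D.θ a b hab (p, q)).1 s).1).2) := by
  rcases h : D.θ a b hab (p, q) with ⟨p', q'⟩
  rcases h₁ : D.comm i b q s with ⟨s₁, q₁⟩
  rcases h₂ : D.comm i a p s₁ with ⟨s₂, p₁⟩
  rcases h₃ : D.comm i a p' s with ⟨s₃, p₃⟩
  rcases h₄ : D.comm i b q' s₃ with ⟨s₄, q₄⟩
  rcases h₅ : D.θ a b hab (p₁, q₁) with ⟨x, y⟩
  simp only [Prod.mk.injEq]
  unfold comm at h₁ h₂ h₃ h₄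
  rcases lt_or_gt_of_ne hbi with hb | hb
  · have ha := hab.trans hb
    rw [dif_pos hb, Prod.swap_eq_iff_eq_swap] at h₁ h₄
    rw [dif_pos ha, Prod.swap_eq_iff_eq_swap] at h₂ h₃
    have := D.cubic a b i hab hb p p₁ x p' p₃ q q₁ y q' q₄ s s₁ s₂ s₃ s₄ h₁ h₂ h₅ h h₃ h₄
    tauto
  · rw [dif_neg hb.not_gt, dif_pos hb, Equiv.symm_apply_eq] at h₁ h₄
    rcases lt_or_gt_of_ne hai with ha | ha
    · rw [dif_pos ha, Prod.swap_eq_iff_eq_swap] at h₂ h₃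
      rcases h₆ : D.θ i b hb (s₂, y) with ⟨z, y₂⟩
      obtain ⟨rfl, rfl, rfl⟩ := D.cubic a i b ha hb _ _ _ _ _ _ _ _ _ _ _ _ _ _ _
        h₁.symm h h₃ h₂ h₅ h₆
      have := (D.θ i b hb).injective (h₆.trans h₄)
      simp_all
    · rw [dif_neg ha.not_gt, dif_pos ha, Equiv.symm_apply_eq] at h₂ h₃
      rcases h₆ : D.θ i b hb (s₂, y) with ⟨z, y₂⟩
      rcases h₇ : D.θ i a ha (z, x) with ⟨z₂, x₂⟩
      obtain ⟨rfl, rfl, rfl⟩ := D.cubic i a b ha hab _ _ _ _ _ _ _ _ _ _ _ _ _ _ _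
        h₅ h₆ h₇ h₂.symm h₁.symm h
      obtain ⟨rfl, rfl⟩ := Prod.mk.inj ((D.θ i a ha).injective (h₇.trans h₃))
      have := (D.θ i b hb).injective (h₆.trans h₄)
      simp_all

theorem factorStep_comm (i : Fin k) {a b : Fin k} (hab : a < b)
    (p : Fin (D.m a)) (q : Fin (D.m b)) :
    D.factorStep i ⟨a, p⟩ * D.factorStep i ⟨b, q⟩
      = D.factorStep i ⟨b, (D.θ a b hab (p, q)).2⟩
        * D.factorStep i ⟨a, (D.θ a b hab (p, q)).1⟩ := by
  funext ⟨w, o⟩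
  change D.factorStep i ⟨a, p⟩ (D.factorStep i ⟨b, q⟩ (w, o)) = D.factorStep i _
    (D.factorStep i _ (w, o))
  have hw : D.edge a p * (D.edge b q * w) = D.edge b (D.θ a b hab (p, q)).2
      * (D.edge a (D.θ a b hab (p, q)).1 * w) := by
    rw [← mul_assoc, edge_mul_edge hab, mul_assoc]
  unfold factorStep
  refine Prod.ext hw ?_
  -- If a or b is the tracked colour, the record is overwritten and `comm` only has to match θ or
  -- its inverse; if neither is, `comm_comm` is needed.
  by_cases ha : a = i
  · subst ha
    have hc : D.comm a b (D.θ a b hab (p, q)).2 (D.θ a b hab (p, q)).1 = (p, q) := by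
      rw [comm, dif_neg hab.not_gt, dif_pos hab, Prod.mk.eta, Equiv.symm_apply_apply]
    simp [hab.ne', hc]
  by_cases hb : b = i
  · subst hb
    have hc : D.comm b a p q = (D.θ a b hab (p, q)).swap := by
      rw [comm, dif_pos hab]
    simp [hab.ne, hc]
  simp only [ha, hb, dif_neg, not_false_eq_true, Option.map_map]
  congr 1
  funext ⟨s, w'⟩
  obtain ⟨h1, h2⟩ := comm_comm hab ha hb p q s
  refine Prod.ext h1 ?_
  simp only [Function.comp_apply, ← mul_assoc]
  rw [edge_mul_edge hab, h2]

variable (D) in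
/-- The action of `𝔽_θ⁺` extending `factorStep`. -/
def factor (i : Fin k) : D.Path →* Function.End (D.Path × Option (Fin (D.m i) × D.Path)) :=
  PresentedMonoid.lift (D.factorStep i) (by
    rintro _ _ ⟨a, b, hab, p, q⟩
    simp only [map_mul, FreeMonoid.lift_eval_of]
    exact factorStep_comm i hab p q)

theorem factor_edge_mul (i j : Fin k) (t : Fin (D.m j)) (w : D.Path)
    (x : D.Path × Option (Fin (D.m i) × D.Path)) :
    D.factor i (D.edge j t * w) x = D.factorStep i ⟨j, t⟩ (D.factor i w x) := by
  rw [map_mul]; rfl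

theorem factor_fst (i : Fin k) (w : D.Path) : (D.factor i w (1, none)).1 = w := by
  induction w using path_induction with
  | one => rw [map_one]; rfl
  | edge_mul j t w ih => rw [factor_edge_mul, factorStep, ih]

/-- Acting on (1, none), the word records its own leading edge of colour i together with the
remainder. Both are therefore determined by the element of 𝔽_θ⁺ and not by the chosen spelling. -/
theorem edge_mul_inj {i : Fin k} {s t : Fin (D.m i)} {v w : D.Path}
    (h : D.edge i s * v = D.edge i t * w) : s = t ∧ v = w := by
  have h1 : ∀ (s : Fin (D.m i)) v, (D.factor i (D.edge i s * v) (1, none)).2 = some (s, v) := by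
    intro s v
    rw [factor_edge_mul, factorStep, factor_fst]
    simp
  have h2 := h1 s v
  rw [h, h1 t w] at h2
  simp only [Option.some.injEq, Prod.mk.injEq] at h2
  exact ⟨h2.1.symm, h2.2.symm⟩

theorem edge_injective (i : Fin k) : Function.Injective (D.edge i) := fun s t h =>
  (edge_mul_inj (v := 1) (w := 1) (by rw [h])).1

/-! ### A set on which `𝔽_θ⁺` acts by partial inverses of shifts -/

variable (D) in
/-- Formal quotients `w τ⁻ⁿ`. -/
def rightFractionSetoid (τ : D.Path) : Setoid (D.Path × ℕ) where
  r x y := ∃ N, x.1 * τ ^ (N + y.2) = y.1 * τ ^ (N + x.2)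
  iseqv :=
    { refl := fun x => ⟨0, rfl⟩
      symm := fun ⟨N, h⟩ => ⟨N, h.symm⟩
      trans := by
        rintro ⟨x, a⟩ ⟨y, b⟩ ⟨z, c⟩ ⟨N, h⟩ ⟨M, h'⟩
        refine ⟨N + M + b, ?_⟩
        dsimp only at *
        calc x * τ ^ (N + M + b + c) = x * τ ^ (N + b) * τ ^ (M + c) := by
              rw [mul_assoc, ← pow_add]; congr 2; ring
          _ = y * τ ^ (M + c) * τ ^ (N + a) := by
              rw [h, mul_assoc, mul_assoc, ← pow_add, ← pow_add, add_comm]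
          _ = z * τ ^ (N + M + b + a) := by
              rw [h', mul_assoc, ← pow_add]; congr 2; ring }

variable (D) in
/-- The set of formal quotients `w τ⁻ⁿ`. -/
def RightFraction (τ : D.Path) : Type := Quotient (D.rightFractionSetoid τ)

/-- Left multiplication by an edge. -/
def RightFraction.cons {τ : D.Path} (i : Fin k) (s : Fin (D.m i)) :
    D.RightFraction τ → D.RightFraction τ :=
  Quotient.map (fun x => (D.edge i s * x.1, x.2)) (by
    rintro x y ⟨N, h⟩
    exact ⟨N, by simp only [mul_assoc, h]⟩)

theorem RightFraction.cons_cons {τ : D.Path} {i j : Fin k} (hij : i < j) (s : Fin (D.m i))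
    (t : Fin (D.m j)) (x : D.RightFraction τ) :
    cons i s (cons j t x) = cons j (D.θ i j hij (s, t)).2 (cons i (D.θ i j hij (s, t)).1 x) := by
  induction x using Quotient.inductionOn with | _ x
  refine congrArg (Quotient.mk _) ?_
  simp only [← mul_assoc, edge_mul_edge hij]

theorem RightFraction.cons_inj {τ : D.Path} {i : Fin k} {s t : Fin (D.m i)}
    {x y : D.RightFraction τ} (h : cons i s x = cons i t y) : s = t ∧ x = y := by
  induction x using Quotient.inductionOn with | _ x
  induction y using Quotient.inductionOn with | _ y
  obtain ⟨N, h⟩ := Quotient.exact h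
  simp only [mul_assoc] at h
  obtain ⟨h1, h2⟩ := edge_mul_inj h
  exact ⟨h1, Quotient.sound ⟨N, h2⟩⟩

/-- Rewriting w τ⁻ⁿ as (w τ) τ⁻⁽ⁿ⁺¹⁾ puts an edge of colour i into the numerator. On 𝔽_θ⁺ itself
this surjectivity fails, since 1 has no leading edge; hence the fractions. -/
theorem RightFraction.exists_eq_cons {τ : D.Path} (i : Fin k) (hτ : D.deg τ i ≠ 0)
    (x : D.RightFraction τ) : ∃ s y, x = cons i s y := by
  induction x using Quotient.inductionOn with | _ x
  obtain ⟨w, n⟩ := x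
  obtain ⟨s, v, h⟩ := exists_eq_edge_mul (w := w * τ) (i := i) (by
    rw [deg_mul, Pi.add_apply]; omega)
  refine ⟨s, Quotient.mk _ (v, n + 1), Quotient.sound ⟨0, ?_⟩⟩
  change w * τ ^ (0 + (n + 1)) = D.edge i s * v * τ ^ (0 + n)
  rw [← h, mul_assoc, ← pow_succ', zero_add, zero_add]

theorem exists_forall_deg_ne_zero (hm : ∀ i, 0 < D.m i) : ∃ τ : D.Path, ∀ i, D.deg τ i ≠ 0 := by
  suffices h : ∀ l : List (Fin k), ∃ τ : D.Path, ∀ i ∈ l, D.deg τ i ≠ 0 by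
    obtain ⟨τ, hτ⟩ := h (List.finRange k)
    exact ⟨τ, fun i => hτ i (List.mem_finRange i)⟩
  intro l
  induction l with
  | nil => exact ⟨1, by simp⟩
  | cons j l ih =>
    obtain ⟨τ, hτ⟩ := ih
    refine ⟨D.edge j ⟨0, hm j⟩ * τ, fun i hi => ?_⟩
    by_cases hij : i = j
    · subst hij; rw [deg_edge_mul_self]; omega
    · rw [deg_edge_mul_of_ne hij]
      exact hτ i ((List.mem_cons.1 hi).resolve_left hij)

end SingleVertexGraph

/-! ### Composition operators on `ℓ²` -/

section CompositionOperator

open ENNReal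

variable {X : Type*}

theorem Memℓp.comp_injective {g : X → ℂ} (hg : Memℓp g 2) {f : X → X}
    (hf : Function.Injective f) : Memℓp (g ∘ f) 2 := by
  rw [memℓp_gen_iff (by norm_num)] at hg ⊢
  exact hg.comp_injective hf

/-- Composition with an injective map as an operator on `ℓ²`. -/
noncomputable def compOp (f : X → X) (hf : Function.Injective f) :
    lp (fun _ : X => ℂ) 2 →L[ℂ] lp (fun _ : X => ℂ) 2 :=
  LinearMap.mkContinuous
    { toFun := fun g => ⟨g ∘ f, (lp.memℓp g).comp_injective hf⟩
      map_add' := fun _ _ => rfl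
      map_smul' := fun _ _ => rfl } 1 (by
    intro g
    rw [one_mul]
    refine lp.norm_le_of_tsum_le (by norm_num) (norm_nonneg _) ?_
    rw [lp.norm_rpow_eq_tsum (by norm_num)]
    exact tsum_comp_le_tsum_of_inj ((memℓp_gen_iff (by norm_num)).1 (lp.memℓp g))
      (fun _ => by positivity) hf)

theorem compOp_apply (f : X → X) (hf : Function.Injective f) (g : lp (fun _ : X => ℂ) 2) (x : X) :
    compOp f hf g x = g (f x) := rfl

/-- The adjoint pushes basis vectors forward along f, so the adjoints multiply in the order in which
the maps are composed. -/
theorem star_compOp_single [DecidableEq X] (f : X → X) (hf : Function.Injective f) (x : X) :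
    star (compOp f hf) (lp.single 2 x 1) = lp.single 2 (f x) 1 := by
  refine ext_inner_right ℂ fun g => ?_
  rw [ContinuousLinearMap.star_eq_adjoint, ContinuousLinearMap.adjoint_inner_left,
    lp.inner_single_left, lp.inner_single_left, compOp_apply]

theorem compOp_single [DecidableEq X] (f : X → X) (hf : Function.Injective f) (x : X) :
    compOp f hf (lp.single 2 (f x) 1) = lp.single 2 x 1 := by
  ext y
  rw [compOp_apply, lp.single_apply, lp.single_apply]
  simp [Pi.single_apply, hf.eq_iff]

theorem compOp_single_of_ne [DecidableEq X] (f : X → X) (hf : Function.Injective f) {x : X}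
    (hx : ∀ y, f y ≠ x) : compOp f hf (lp.single 2 x 1) = 0 := by
  ext y
  rw [compOp_apply, lp.single_apply]
  simp [hx y]

theorem ext_lp_single [DecidableEq X] {S T : lp (fun _ : X => ℂ) 2 →L[ℂ] lp (fun _ : X => ℂ) 2}
    (h : ∀ x, S (lp.single 2 x 1) = T (lp.single 2 x 1)) : S = T := by
  refine lp.ext_continuousLinearMap (by norm_num) fun x => ContinuousLinearMap.ext_ring ?_
  exact h x

theorem star_compOp_mul_star_compOp {f g f' g' : X → X} (hf : Function.Injective f)
    (hg : Function.Injective g) (hf' : Function.Injective f') (hg' : Function.Injective g')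
    (h : ∀ x, f (g x) = f' (g' x)) :
    star (compOp f hf) * star (compOp g hg) = star (compOp f' hf') * star (compOp g' hg') := by
  classical
  refine ext_lp_single fun x => ?_
  change star (compOp f hf) (star (compOp g hg) _) = star (compOp f' hf') (star (compOp g' hg') _)
  simp only [star_compOp_single, h]

theorem isCuntzTuple_star_compOp {n : ℕ} (f : Fin n → X → X)
    (hi : ∀ s, Function.Injective (f s)) (hf : ∀ s t x y, f s x = f t y → s = t)
    (hs : ∀ x, ∃ s y, x = f s y) :
    IsCuntzTuple fun s => star (compOp (f s) (hi s)) := by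
  classical
  have hne : ∀ s t, s ≠ t → ∀ x y, f s y ≠ f t x := fun s t hst x y h => hst (hf s t y x h)
  refine ⟨fun s t => ext_lp_single fun x => ?_, ext_lp_single fun x => ?_⟩
  · change star (star (compOp (f s) (hi s))) (star (compOp (f t) (hi t)) _) = _
    rw [star_star, star_compOp_single]
    split_ifs with hst
    · subst hst
      rw [compOp_single]; rfl
    · rw [compOp_single_of_ne _ _ (hne s t hst x)]; rfl
  · obtain ⟨s, y, rfl⟩ := hs x
    have h : ∀ t x, (star (compOp (f t) (hi t)) * star (star (compOp (f t) (hi t)))) x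
        = star (compOp (f t) (hi t)) (compOp (f t) (hi t) x) := fun t x => by rw [star_star]; rfl
    rw [sum_apply, Finset.sum_eq_single s]
    · rw [h, compOp_single, star_compOp_single]; rfl
    · intro t _ hts
      rw [h, compOp_single_of_ne _ _ (hne t s hts y),
        map_zero]
    · simp

end CompositionOperator

/-! ### Existence of a representation: 𝒪_θ is nonzero -/

namespace SingleVertexGraph

variable {k : ℕ} {D : SingleVertexGraph k}

/-- For each colour the shifts by edges are injective on the fractions, and their ranges partition
the set, so they induce isometries of Cuntz type on ℓ². -/
theorem nonempty_cuntzRep (hm : ∀ i, 0 < D.m i) : Nonempty (CuntzRep.{u} D) := by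
  classical
  obtain ⟨τ, hτ⟩ := exists_forall_deg_ne_zero hm
  let X := ULift.{u} (D.RightFraction τ)
  let f : ∀ i, Fin (D.m i) → X → X := fun i s x => ⟨RightFraction.cons i s x.down⟩
  have hf : ∀ i s t x y, f i s x = f i t y → s = t ∧ x = y := by
    rintro i s t ⟨x⟩ ⟨y⟩ h
    obtain ⟨h1, h2⟩ := RightFraction.cons_inj (ULift.up_injective h)
    exact ⟨h1, congrArg _ h2⟩
  have hs : ∀ i x, ∃ s y, x = f i s y := by
    rintro i ⟨x⟩
    obtain ⟨s, y, h⟩ := RightFraction.exists_eq_cons i (hτ i) x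
    exact ⟨s, ⟨y⟩, congrArg _ h⟩
  have hi : ∀ i s, Function.Injective (f i s) := fun i s x y h => (hf i s s x y h).2
  have hn : Nontrivial (lp (fun _ : X => ℂ) 2) := by
    refine ⟨lp.single 2 ⟨Quotient.mk _ (1, 0)⟩ 1, 0, fun h => ?_⟩
    have := congrArg (fun g : lp (fun _ : X => ℂ) 2 => g ⟨Quotient.mk _ (1, 0)⟩) h
    simp at this
  exact ⟨{
    carrier := lp (fun _ : X => ℂ) 2 →L[ℂ] lp (fun _ : X => ℂ) 2
    E := fun i s => star (compOp (f i s) (hi i s))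
    isRep :=
      { cuntz := fun i => isCuntzTuple_star_compOp (f i) (hi i)
          (fun s t x y h => (hf i s t x y h).1) (hs i)
        comm := fun i j hij s t => by
          refine star_compOp_mul_star_compOp _ _ _ _ fun x => ?_
          exact congrArg ULift.up (RightFraction.cons_cons hij s t x.down) } }⟩

theorem nontrivial_cstarAlg (hm : ∀ i, 0 < D.m i) : Nontrivial (CStarAlg.{u} D) := by
  obtain ⟨ρ⟩ := nonempty_cuntzRep.{u} hm
  refine ⟨1, 0, fun h => ?_⟩
  have h1 : ((1 : genSubalgebra.{u} D) : RepProd.{u} D) ρ = ((0 : genSubalgebra.{u} D) :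
      RepProd.{u} D) ρ := congrArg (fun x : genSubalgebra.{u} D => (x : RepProd.{u} D) ρ) h
  exact one_ne_zero (α := ρ.carrier) h1

end SingleVertexGraph

theorem norm_le_one_of_star_mul_self {A : Type*} [CStarAlgebra A] {a : A} (h : star a * a = 1) :
    ‖a‖ ≤ 1 := by
  have h2 := CStarRing.norm_star_mul_self (x := a)
  rw [h] at h2
  rcases subsingleton_or_nontrivial A with hA | hA
  · simp [Subsingleton.elim a 0]
  · rw [CStarRing.norm_one] at h2
    nlinarith [norm_nonneg a]

namespace SingleVertexGraph

variable {k : ℕ} {D : SingleVertexGraph k}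

/-! ### Relations in `𝒪_θ` -/

theorem wordOp_edge (i : Fin k) (s : Fin (D.m i)) : wordOp.{u} D (D.edge i s) = gen D i s := rfl

theorem wordOp_edge_mul (i : Fin k) (s : Fin (D.m i)) (w : D.Path) :
    wordOp.{u} D (D.edge i s * w) = gen D i s * wordOp D w := by
  rw [map_mul, wordOp_edge]

theorem star_gen_mul_gen (i : Fin k) (s t : Fin (D.m i)) :
    star (gen.{u} D i s) * gen D i t = if s = t then 1 else 0 :=
  ((isCuntzRep_gen D).cuntz i).1 s t

theorem sum_gen_mul_star_gen (i : Fin k) : ∑ s, gen.{u} D i s * star (gen D i s) = 1 :=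
  ((isCuntzRep_gen D).cuntz i).2

theorem gen_mul_gen {i j : Fin k} (hij : i < j) (s : Fin (D.m i)) (t : Fin (D.m j)) :
    gen.{u} D i s * gen D j t
      = gen D j (D.θ i j hij (s, t)).2 * gen D i (D.θ i j hij (s, t)).1 :=
  (isCuntzRep_gen D).comm i j hij s t

theorem star_wordOp_mul_self (w : D.Path) : star (wordOp.{u} D w) * wordOp D w = 1 := by
  induction w using path_induction with
  | one => simp
  | edge_mul i s w ih =>
    rw [wordOp_edge_mul, star_mul, mul_assoc, ← mul_assoc (star (gen D i s)), star_gen_mul_gen,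
      if_pos rfl, one_mul, ih]

theorem norm_wordOp_le (w : D.Path) : ‖wordOp.{u} D w‖ ≤ 1 :=
  norm_le_one_of_star_mul_self (star_wordOp_mul_self w)

theorem norm_gen_le (i : Fin k) (s : Fin (D.m i)) : ‖gen.{u} D i s‖ ≤ 1 :=
  norm_wordOp_le (D.edge i s)

/-- Insert 1 = ∑ₐ s^j_a (s^j_a)⋆ on the right and commute s^i_s past s^j_a. A term survives only if
the new leading edge is e^j_t, and each such a gives a minimal common extension of e^i_s and e^j_t.
The pull-back property leaves at most one term. -/
theorem star_gen_mul_gen_of_lt (hD : D.LittlePullback) {i j : Fin k} (hij : i < j)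
    (t : Fin (D.m j)) (s : Fin (D.m i)) :
    star (gen.{u} D j t) * gen D i s = 0 ∨
      ∃ s' t', star (gen.{u} D j t) * gen D i s = gen D i s' * star (gen D j t') := by
  have key : star (gen.{u} D j t) * gen D i s = ∑ a, if t = (D.θ i j hij (s, a)).2 then
      gen D i (D.θ i j hij (s, a)).1 * star (gen D j a) else 0 := by
    rw [← mul_one (star (gen D j t) * gen D i s), ← sum_gen_mul_star_gen j, Finset.mul_sum]
    refine Finset.sum_congr rfl fun a _ => ?_
    rw [← mul_assoc, mul_assoc (star _) (gen D i s), gen_mul_gen hij, ← mul_assoc,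
      star_gen_mul_gen]
    split_ifs <;> simp
  have uniq : ∀ a b, t = (D.θ i j hij (s, a)).2 → t = (D.θ i j hij (s, b)).2 → a = b := by
    intro a b ha hb
    have h := hD (D.edge i s) (D.edge j t) ⟨i, rfl⟩ ⟨j, rfl⟩ (by
      rw [deg_edge, deg_edge]
      intro h
      have := congrFun h i
      simp [hij.ne] at this)
    have hmem : ∀ a, t = (D.θ i j hij (s, a)).2 →
        (D.edge j a, D.edge i (D.θ i j hij (s, a)).1) ∈ D.minExt (D.edge i s) (D.edge j t) := by
      rintro a rfl
      refine ⟨edge_mul_edge hij s a, ?_⟩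
      rw [deg_mul, deg_edge, deg_edge, deg_edge]
      funext l
      simp only [Pi.add_apply, Pi.sup_apply, Pi.single_apply]
      have := hij.ne
      split_ifs <;> simp_all
    exact edge_injective j (Prod.mk.inj (Set.encard_le_one_iff.1 h _ _ (hmem a ha) (hmem b hb))).1
  by_cases hex : ∃ a, t = (D.θ i j hij (s, a)).2
  · obtain ⟨a, ha⟩ := hex
    refine .inr ⟨(D.θ i j hij (s, a)).1, a, ?_⟩
    rw [key, Finset.sum_eq_single a, if_pos ha]
    · exact fun b _ hba => if_neg fun hb => hba (uniq b a hb ha)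
    · simp
  · push Not at hex
    exact .inl (key.trans (Finset.sum_eq_zero fun a _ => if_neg (hex a)))

theorem star_gen_mul_gen_of_ne (hD : D.LittlePullback) {i j : Fin k} (hij : i ≠ j)
    (t : Fin (D.m j)) (s : Fin (D.m i)) :
    star (gen.{u} D j t) * gen D i s = 0 ∨
      ∃ s' t', star (gen.{u} D j t) * gen D i s = gen D i s' * star (gen D j t') := by
  rcases lt_or_gt_of_ne hij with h | h
  · exact star_gen_mul_gen_of_lt hD h t s
  · have e : star (gen.{u} D j t) * gen D i s = star (star (gen D i s) * gen D j t) := by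
      rw [star_mul, star_star]
    rcases star_gen_mul_gen_of_lt.{u} hD h s t with h0 | ⟨t', s', h1⟩
    · exact .inl (by rw [e, h0, star_zero])
    · exact .inr ⟨s', t', by rw [e, h1, star_mul, star_star]⟩

theorem star_wordOp_mul_gen (hD : D.LittlePullback) {i : Fin k} (w : D.Path)
    (hw : D.deg w i = 0) (s : Fin (D.m i)) :
    star (wordOp.{u} D w) * gen D i s = 0 ∨ ∃ s' w', D.deg w' = D.deg w ∧
      star (wordOp.{u} D w) * gen D i s = gen D i s' * star (wordOp D w') := by
  induction w using path_induction generalizing s with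
  | one => exact .inr ⟨s, 1, rfl, by simp⟩
  | edge_mul j t w ih =>
    have hij : i ≠ j := by
      rintro rfl
      rw [deg_edge_mul_self] at hw
      omega
    rw [deg_edge_mul_of_ne hij] at hw
    rw [wordOp_edge_mul, star_mul, mul_assoc]
    rcases star_gen_mul_gen_of_ne.{u} hD hij t s with h0 | ⟨s', t', h1⟩
    · exact .inl (by rw [h0, mul_zero])
    · rw [h1, ← mul_assoc]
      rcases ih hw s' with h0 | ⟨s'', w', hd, h2⟩
      · exact .inl (by rw [h0, zero_mul])
      · refine .inr ⟨s'', D.edge j t' * w', ?_, ?_⟩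
        · rw [deg_mul, deg_mul, hd, deg_edge, deg_edge]
        · rw [h2, wordOp_edge_mul, star_mul, mul_assoc]

/-! ### The spectral subspaces -/

theorem wordOp_mul_star_mem {n : Fin k → ℤ} {u v : D.Path}
    (h : ∀ i, (D.deg u i : ℤ) - D.deg v i = n i) :
    wordOp.{u} D u * star (wordOp D v) ∈ algSpectral.{u} D n :=
  Submodule.subset_span ⟨u, v, h, rfl⟩

theorem one_mem_algSpectral : (1 : CStarAlg.{u} D) ∈ algSpectral.{u} D 0 := by
  have := wordOp_mul_star_mem.{u} (D := D) (n := 0) (u := 1) (v := 1) (by simp)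
  simpa using this

@[elab_as_elim]
theorem algSpectral_induction {n : Fin k → ℤ} {P : ∀ x ∈ algSpectral.{u} D n, Prop}
    (word : ∀ (u v : D.Path) (h : ∀ i, (D.deg u i : ℤ) - D.deg v i = n i),
      P (wordOp D u * star (wordOp D v)) (wordOp_mul_star_mem h))
    (zero : P 0 (zero_mem _))
    (add : ∀ x y hx hy, P x hx → P y hy → P (x + y) (add_mem hx hy))
    (smul : ∀ (c : ℂ) x hx, P x hx → P (c • x) (Submodule.smul_mem _ c hx))
    {x : CStarAlg.{u} D} (hx : x ∈ algSpectral.{u} D n) : P x hx := by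
  refine Submodule.span_induction (p := fun x hx => P x hx) ?_ zero add smul hx
  rintro _ ⟨u, v, h, rfl⟩
  exact word u v h

theorem star_mem_algSpectral {n : Fin k → ℤ} {x : CStarAlg.{u} D} (hx : x ∈ algSpectral.{u} D n) :
    star x ∈ algSpectral.{u} D (-n) := by
  induction hx using algSpectral_induction with
  | word u v h =>
    rw [star_mul, star_star]
    exact wordOp_mul_star_mem fun i => by rw [Pi.neg_apply, ← h i]; ring
  | zero => rw [star_zero]; exact zero_mem _
  | add x y _ _ hx hy => rw [star_add]; exact add_mem hx hy
  | smul c x _ hx => rw [star_smul]; exact Submodule.smul_mem _ _ hx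

theorem gen_mul_mem_algSpectral {n : Fin k → ℤ} {x : CStarAlg.{u} D}
    (hx : x ∈ algSpectral.{u} D n) (i : Fin k) (s : Fin (D.m i)) :
    gen D i s * x ∈ algSpectral.{u} D (n + Pi.single i 1) := by
  induction hx using algSpectral_induction with
  | word u v h =>
    rw [← mul_assoc, ← wordOp_edge_mul]
    refine wordOp_mul_star_mem fun j => ?_
    rw [deg_mul, deg_edge, Pi.add_apply, Pi.add_apply, ← h j, Pi.single_apply, Pi.single_apply]
    push_cast
    ring
  | zero => rw [mul_zero]; exact zero_mem _
  | add x y _ _ hx hy => rw [mul_add]; exact add_mem hx hy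
  | smul c x _ hx => rw [mul_smul_comm]; exact Submodule.smul_mem _ _ hx

theorem star_gen_mul_mem_algSpectral {n : Fin k → ℤ} {x : CStarAlg.{u} D}
    (hx : x ∈ algSpectral.{u} D n) (i : Fin k) (s : Fin (D.m i)) :
    star (gen D i s) * x ∈ algSpectral.{u} D (n - Pi.single i 1) := by
  have main : ∀ u v : D.Path, (∀ j, (D.deg u j : ℤ) - D.deg v j = n j) → D.deg u i ≠ 0 →
      star (gen D i s) * (wordOp D u * star (wordOp D v))
        ∈ algSpectral.{u} D (n - Pi.single i 1) := by
    intro u v h hu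
    obtain ⟨t, u, rfl⟩ := exists_eq_edge_mul hu
    rw [wordOp_edge_mul, mul_assoc, ← mul_assoc, star_gen_mul_gen]
    split_ifs
    · rw [one_mul]
      refine wordOp_mul_star_mem fun j => ?_
      rw [Pi.sub_apply, ← h j, deg_mul, deg_edge, Pi.add_apply, Pi.single_apply, Pi.single_apply]
      push_cast
      ring
    · rw [zero_mul]; exact zero_mem _
  induction hx using algSpectral_induction with
  | word u v h =>
    -- The word u may lack an edge of colour i; inserting ∑ₐ s^i_a (s^i_a)⋆ between the two factors
    -- supplies one without changing the degree difference.
    have e : wordOp.{u} D u * star (wordOp D v) = ∑ a, wordOp D (u * D.edge i a)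
        * star (wordOp D (v * D.edge i a)) := by
      simp only [map_mul, star_mul, wordOp_edge]
      conv_lhs => rw [← mul_one (wordOp D u), ← sum_gen_mul_star_gen i, Finset.mul_sum,
        Finset.sum_mul]
      exact Finset.sum_congr rfl fun a _ => by simp only [mul_assoc]
    rw [e, Finset.mul_sum]
    refine sum_mem fun a _ => main _ _ (fun j => ?_) ?_
    · rw [deg_mul, deg_mul, deg_edge, ← h j, Pi.add_apply, Pi.add_apply]
      push_cast
      ring
    · rw [deg_mul, deg_edge, Pi.add_apply, Pi.single_eq_same]
      omega
  | zero => rw [mul_zero]; exact zero_mem _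
  | add x y _ _ hx hy => rw [mul_add]; exact add_mem hx hy
  | smul c x _ hx => rw [mul_smul_comm]; exact Submodule.smul_mem _ _ hx

theorem wordOp_mul_mem_algSpectral (w : D.Path) {n : Fin k → ℤ} {x : CStarAlg.{u} D}
    (hx : x ∈ algSpectral.{u} D n) :
    wordOp D w * x ∈ algSpectral.{u} D (n + fun i => (D.deg w i : ℤ)) := by
  induction w using path_induction with
  | one =>
    rw [map_one, one_mul, deg_one]
    convert hx using 2
    funext j
    simp
  | edge_mul i s w ih =>
    rw [wordOp_edge_mul, mul_assoc]
    convert gen_mul_mem_algSpectral ih i s using 2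
    funext j
    simp only [deg_mul, deg_edge, Pi.add_apply, Pi.single_apply]
    push_cast
    ring

theorem star_wordOp_mul_mem_algSpectral (w : D.Path) {n : Fin k → ℤ} {x : CStarAlg.{u} D}
    (hx : x ∈ algSpectral.{u} D n) :
    star (wordOp D w) * x ∈ algSpectral.{u} D (n - fun i => (D.deg w i : ℤ)) := by
  induction w using path_induction generalizing n x with
  | one =>
    rw [map_one, star_one, one_mul, deg_one]
    convert hx using 2
    funext j
    simp
  | edge_mul i s w ih =>
    rw [wordOp_edge_mul, star_mul, mul_assoc]
    convert ih (star_gen_mul_mem_algSpectral hx i s) using 2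
    funext j
    simp only [deg_mul, deg_edge, Pi.add_apply, Pi.sub_apply, Pi.single_apply]
    push_cast
    ring

theorem mul_mem_algSpectral {n p : Fin k → ℤ} {x y : CStarAlg.{u} D}
    (hx : x ∈ algSpectral.{u} D n) (hy : y ∈ algSpectral.{u} D p) :
    x * y ∈ algSpectral.{u} D (n + p) := by
  induction hx using algSpectral_induction with
  | word u v h =>
    rw [mul_assoc]
    convert wordOp_mul_mem_algSpectral u (star_wordOp_mul_mem_algSpectral v hy) using 2
    funext j
    simp only [Pi.add_apply, Pi.sub_apply, ← h j]
    ring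
  | zero => rw [zero_mul]; exact zero_mem _
  | add x z _ _ hx hz => rw [add_mul]; exact add_mem hx hz
  | smul c x _ hx => rw [smul_mul_assoc]; exact Submodule.smul_mem _ _ hx

variable (D) in
/-- The inclusion of `𝒪_θ` into the product of all representations. -/
noncomputable def toProd : CStarAlg.{u} D →⋆ₐ[ℂ] RepProd.{u} D := (genSubalgebra.{u} D).subtype

theorem norm_toProd (x : CStarAlg.{u} D) : ‖toProd D x‖ = ‖x‖ := rfl

/-- The sum of the spectral subspaces is closed under products and adjoints and contains the
generators, so it exhausts the dense star subalgebra that they generate. -/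
theorem exists_mem_iSup_algSpectral_norm_sub_lt (x : CStarAlg.{u} D) {ε : ℝ} (hε : 0 < ε) :
    ∃ b ∈ ⨆ n, algSpectral.{u} D n, ‖x - b‖ < ε := by
  have key : ∀ y ∈ StarAlgebra.adjoin ℂ (Set.range fun e : D.Gen => prodGen.{u} D e.1 e.2),
      ∃ b ∈ ⨆ n, algSpectral.{u} D n, toProd D b = y := by
    have hle : ∀ n, algSpectral.{u} D n ≤ ⨆ n, algSpectral.{u} D n :=
      fun n => le_iSup (fun n => algSpectral.{u} D n) n
    intro y hy
    induction hy using StarAlgebra.adjoin_induction with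
    | mem y hy =>
      obtain ⟨e, rfl⟩ := hy
      refine ⟨gen D e.1 e.2, hle (0 + Pi.single e.1 1) ?_, rfl⟩
      simpa using gen_mul_mem_algSpectral one_mem_algSpectral e.1 e.2
    | algebraMap c =>
      refine ⟨algebraMap ℂ _ c, ?_, AlgHomClass.commutes (toProd.{u} D) c⟩
      rw [Algebra.algebraMap_eq_smul_one]
      exact Submodule.smul_mem _ _ (hle 0 one_mem_algSpectral)
    | add x y _ _ hx hy =>
      obtain ⟨a, ha, rfl⟩ := hx
      obtain ⟨b, hb, rfl⟩ := hy
      exact ⟨a + b, add_mem ha hb, map_add _ _ _⟩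
    | mul x y _ _ hx hy =>
      obtain ⟨a, ha, rfl⟩ := hx
      obtain ⟨b, hb, rfl⟩ := hy
      refine ⟨a * b, ?_, map_mul _ _ _⟩
      clear * - ha hb hle
      induction ha using Submodule.iSup_induction' with
      | mem n a ha =>
        induction hb using Submodule.iSup_induction' with
        | mem p b hb => exact hle _ (mul_mem_algSpectral ha hb)
        | zero => rw [mul_zero]; exact zero_mem _
        | add b b' _ _ hb hb' => rw [mul_add]; exact add_mem hb hb'
      | zero => rw [zero_mul]; exact zero_mem _
      | add a a' _ _ ha ha' => rw [add_mul]; exact add_mem ha ha'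
    | star x _ hx =>
      obtain ⟨a, ha, rfl⟩ := hx
      refine ⟨star a, ?_, map_star _ _⟩
      clear * - ha hle
      induction ha using Submodule.iSup_induction' with
      | mem n a ha => exact hle _ (star_mem_algSpectral ha)
      | zero => rw [star_zero]; exact zero_mem _
      | add a a' _ _ ha ha' => rw [star_add]; exact add_mem ha ha'
  have hx : toProd D x ∈ closure (StarAlgebra.adjoin ℂ (Set.range fun e : D.Gen =>
      prodGen.{u} D e.1 e.2) : Set (RepProd.{u} D)) := x.2
  obtain ⟨y, hy, hxy⟩ := Metric.mem_closure_iff.1 hx ε hε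
  obtain ⟨b, hb, rfl⟩ := key y hy
  refine ⟨b, hb, ?_⟩
  rwa [dist_eq_norm, ← map_sub, norm_toProd] at hxy

/-! ### Averaging maps -/

variable (D) in
/-- The unital completely positive map `x ↦ m_i⁻¹ ∑ₛ (s^i_s)⋆ x s^i_s`. -/
noncomputable def avg (i : Fin k) : Module.End ℂ (CStarAlg.{u} D) :=
  (D.m i : ℂ)⁻¹ • ∑ s, LinearMap.mulLeft ℂ (star (gen D i s)) * LinearMap.mulRight ℂ (gen D i s)

theorem avg_apply (i : Fin k) (x : CStarAlg.{u} D) :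
    avg D i x = (D.m i : ℂ)⁻¹ • ∑ s, star (gen D i s) * x * gen D i s := by
  simp [avg, LinearMap.sum_apply, mul_assoc]

/-- Both composites are sums over pairs of edges, and the permutation θ matches them term by term
through the commutation relation. -/
theorem avg_mul_avg_of_lt {i j : Fin k} (hij : i < j) :
    avg.{u} D i * avg D j = avg D j * avg D i := by
  ext x
  simp only [Module.End.mul_apply, avg_apply, mul_smul_comm, smul_mul_assoc, ← Finset.smul_sum]
  rw [smul_comm]
  congr 2
  simp only [Finset.mul_sum, Finset.sum_mul]
  rw [Finset.sum_comm (f := fun b a => star (gen.{u} D j b)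
    * (star (gen D i a) * x * gen D i a) * gen D j b)]
  rw [← Finset.sum_product', ← Finset.sum_product', Finset.univ_product_univ,
    ← Equiv.sum_comp (D.θ i j hij) (fun p => star (gen.{u} D i p.1) * (star (gen D j p.2) * x
      * gen D j p.2) * gen D i p.1)]
  refine Finset.sum_congr rfl fun p _ => ?_
  have h := gen_mul_gen.{u} hij p.1 p.2
  have h' := congrArg star h
  rw [star_mul, star_mul] at h'
  simp only [← mul_assoc, Prod.mk.eta] at *
  rw [h', mul_assoc, mul_assoc, ← h]
  simp only [mul_assoc]

theorem avg_mul_avg (i j : Fin k) : avg.{u} D i * avg D j = avg D j * avg D i := by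
  rcases lt_trichotomy i j with h | rfl | h
  · exact avg_mul_avg_of_lt h
  · rfl
  · exact (avg_mul_avg_of_lt h).symm

variable (D) in
/-- The commutative monoid generated by the averaging maps. -/
noncomputable def avgMonoid : Submonoid (Module.End ℂ (CStarAlg.{u} D)) :=
  Submonoid.closure (Set.range (avg D))

theorem avg_mem (i : Fin k) : avg.{u} D i ∈ avgMonoid D := Submonoid.subset_closure ⟨i, rfl⟩

theorem avgMonoid_mul_comm {S T : Module.End ℂ (CStarAlg.{u} D)} (hS : S ∈ avgMonoid D)
    (hT : T ∈ avgMonoid D) : S * T = T * S := by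
  have h1 : ∀ i, Commute (avg.{u} D i) T := fun i => by
    induction hT using Submonoid.closure_induction with
    | mem x hx => obtain ⟨j, rfl⟩ := hx; exact avg_mul_avg i j
    | one => exact Commute.one_right _
    | mul x y _ _ hx hy => exact hx.mul_right hy
  induction hS using Submonoid.closure_induction with
  | mem x hx => obtain ⟨j, rfl⟩ := hx; exact h1 j
  | one => exact Commute.one_left _
  | mul x y _ _ hx hy => exact Commute.mul_left hx hy

theorem norm_avg_le (i : Fin k) (x : CStarAlg.{u} D) : ‖avg D i x‖ ≤ ‖x‖ := by
  rw [avg_apply, norm_smul, norm_inv, Complex.norm_natCast]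
  have h : ‖∑ s, star (gen.{u} D i s) * x * gen D i s‖ ≤ D.m i * ‖x‖ := by
    refine (norm_sum_le_of_le (f := fun s => star (gen.{u} D i s) * x * gen D i s)
      (n := fun _ => ‖x‖) _ fun s _ => ?_).trans (by simp)
    have h1 := norm_gen_le.{u} i s
    calc ‖star (gen.{u} D i s) * x * gen D i s‖ ≤ ‖gen.{u} D i s‖ * ‖x‖ * ‖gen.{u} D i s‖ := by
          refine (norm_mul_le _ _).trans ?_
          gcongr
          refine (norm_mul_le _ _).trans ?_
          rw [norm_star]
      _ ≤ 1 * ‖x‖ * 1 := by gcongr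
      _ = ‖x‖ := by ring
  rcases Nat.eq_zero_or_pos (D.m i) with h0 | h0
  · simp only [h0, Nat.cast_zero, inv_zero, zero_mul]; exact norm_nonneg _
  · rw [inv_mul_le_iff₀ (by positivity)]
    exact h

theorem norm_le_of_mem_avgMonoid {S : Module.End ℂ (CStarAlg.{u} D)} (hS : S ∈ avgMonoid D)
    (x : CStarAlg.{u} D) : ‖S x‖ ≤ ‖x‖ := by
  induction hS using Submonoid.closure_induction generalizing x with
  | mem S hS => obtain ⟨j, rfl⟩ := hS; exact norm_avg_le j x
  | one => rfl
  | mul S T _ _ hS hT => exact (hS _).trans (hT x)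

theorem avg_one (hm : ∀ i, 1 < D.m i) (i : Fin k) : avg D i (1 : CStarAlg.{u} D) = 1 := by
  have h0 : (D.m i : ℂ) ≠ 0 := Nat.cast_ne_zero.2 (by have := hm i; omega)
  rw [avg_apply]
  simp only [mul_one, star_gen_mul_gen, if_true, Finset.sum_const, Finset.card_univ,
    Fintype.card_fin]
  rw [← Nat.cast_smul_eq_nsmul ℂ, smul_smul, inv_mul_cancel₀ h0, one_smul]

theorem map_one_of_mem_avgMonoid (hm : ∀ i, 1 < D.m i) {S : Module.End ℂ (CStarAlg.{u} D)}
    (hS : S ∈ avgMonoid D) : S 1 = 1 := by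
  induction hS using Submonoid.closure_induction with
  | mem S hS => obtain ⟨j, rfl⟩ := hS; exact avg_one hm j
  | one => rfl
  | mul S T _ _ hS hT => rw [Module.End.mul_apply, hT, hS]

theorem avg_star (i : Fin k) (x : CStarAlg.{u} D) : avg D i (star x) = star (avg D i x) := by
  simp only [avg_apply, star_smul, star_sum, star_mul, star_star, star_inv₀, star_natCast,
    mul_assoc]

theorem avg_edge_edge {i : Fin k} (s t : Fin (D.m i)) (u v : D.Path) :
    avg.{u} D i (wordOp D (D.edge i s * u) * star (wordOp D (D.edge i t * v)))
      = if s = t then (D.m i : ℂ)⁻¹ • (wordOp D u * star (wordOp D v)) else 0 := by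
  have h : ∀ a, star (gen.{u} D i a) * (gen D i s * wordOp D u * (star (wordOp D v)
      * star (gen D i t))) * gen D i a = if a = s then (if s = t then
        wordOp D u * star (wordOp D v) else 0) else 0 := by
    intro a
    rw [mul_assoc (gen D i s), ← mul_assoc, star_gen_mul_gen, mul_assoc, mul_assoc, mul_assoc,
      star_gen_mul_gen]
    by_cases h1 : a = s
    · subst h1
      by_cases h2 : a = t
      · subst h2; simp
      · simp [h2, Ne.symm h2]
    · simp [h1]
  rw [avg_apply, wordOp_edge_mul, wordOp_edge_mul, star_mul, Finset.sum_congr rfl fun a _ => h a,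
    Finset.sum_ite_eq' Finset.univ s, if_pos (Finset.mem_univ _)]
  split_ifs <;> simp

theorem avg_edge_of_deg_eq_zero {i : Fin k} (s : Fin (D.m i)) (u v : D.Path) :
    avg.{u} D i (wordOp D (D.edge i s * u) * star (wordOp D v))
      = (D.m i : ℂ)⁻¹ • (wordOp D u * (star (wordOp D v) * gen D i s)) := by
  rw [avg_apply, Finset.sum_eq_single s]
  · rw [wordOp_edge_mul, mul_assoc (gen D i s), ← mul_assoc (star _), star_gen_mul_gen, if_pos rfl,
      one_mul, mul_assoc]
  · intro a _ ha
    rw [wordOp_edge_mul, mul_assoc (gen D i s), ← mul_assoc (star _), star_gen_mul_gen, if_neg ha,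
      zero_mul, zero_mul]
  · simp

/-- Stripping the leading edge of u costs m_i⁻¹ and leaves s_v⋆ s^i_s, which is 0 or s^i_{s'}
s_{v'}⋆. In the second case the edge re-enters at the end of u and v' still has no edge of colour i,
so the step can be repeated indefinitely. -/
theorem norm_avg_pow_le (hD : D.LittlePullback) {i : Fin k} (u v : D.Path)
    (hu : D.deg u i ≠ 0) (hv : D.deg v i = 0) (r : ℕ) :
    ‖(avg.{u} D i ^ r) (wordOp D u * star (wordOp D v))‖ ≤ ((D.m i : ℝ)⁻¹) ^ r := by
  induction r generalizing u v with
  | zero =>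
    rw [pow_zero, pow_zero, Module.End.one_apply]
    refine (norm_mul_le _ _).trans ?_
    rw [norm_star]
    exact mul_le_one₀ (norm_wordOp_le u) (norm_nonneg _) (norm_wordOp_le v)
  | succ r ih =>
    obtain ⟨s, u, rfl⟩ := exists_eq_edge_mul hu
    rw [pow_succ, Module.End.mul_apply, avg_edge_of_deg_eq_zero]
    rcases star_wordOp_mul_gen.{u} hD v hv s with h0 | ⟨s', v', hd, h1⟩
    · rw [h0, mul_zero, smul_zero, map_zero, norm_zero]
      positivity
    · rw [h1, ← mul_assoc, ← wordOp_edge, ← map_mul, map_smul, norm_smul, norm_inv,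
        Complex.norm_natCast, pow_succ']
      gcongr
      refine ih _ _ ?_ (hd ▸ hv)
      rw [deg_mul, deg_edge, Pi.add_apply, Pi.single_eq_same]
      omega

theorem avg_pow_star (i : Fin k) (r : ℕ) (x : CStarAlg.{u} D) :
    (avg D i ^ r) (star x) = star ((avg D i ^ r) x) := by
  induction r generalizing x with
  | zero => rfl
  | succ r ih => rw [pow_succ, Module.End.mul_apply, Module.End.mul_apply, avg_star, ih]

/-- Leading edges of colour i are removed in pairs until one word has none left. The decay estimate
then applies directly, or after taking adjoints if u is the word that runs out. -/
theorem exists_avg_pow_lt (hm : ∀ i, 1 < D.m i) (hD : D.LittlePullback) {i : Fin k} (u v : D.Path)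
    (huv : D.deg u i ≠ D.deg v i) {ε : ℝ} (hε : 0 < ε) :
    ∃ r, ‖(avg.{u} D i ^ r) (wordOp D u * star (wordOp D v))‖ < ε := by
  have h1 : (1 : ℝ) < D.m i := by exact_mod_cast hm i
  obtain ⟨r, hr⟩ := exists_pow_lt_of_lt_one hε (inv_lt_one_of_one_lt₀ h1)
  induction hn : D.deg u i using Nat.strong_induction_on generalizing u v with
  | _ n ih =>
  subst hn
  by_cases hu : D.deg u i = 0
  · refine ⟨r, ?_⟩
    have e : wordOp.{u} D u * star (wordOp D v) = star (wordOp D v * star (wordOp D u)) := by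
      rw [star_mul, star_star]
    rw [e, avg_pow_star, norm_star]
    exact (norm_avg_pow_le hD v u (fun h => huv (hu.trans h.symm)) hu r).trans_lt hr
  by_cases hv : D.deg v i = 0
  · exact ⟨r, (norm_avg_pow_le hD u v hu hv r).trans_lt hr⟩
  obtain ⟨s, u, rfl⟩ := exists_eq_edge_mul hu
  obtain ⟨t, v, rfl⟩ := exists_eq_edge_mul hv
  rw [deg_edge_mul_self, deg_edge_mul_self] at huv
  obtain ⟨r, h⟩ := ih (D.deg u i) (by rw [deg_edge_mul_self]; omega) u v (by omega) rfl
  refine ⟨r + 1, ?_⟩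
  rw [pow_succ, Module.End.mul_apply, avg_edge_edge]
  split_ifs
  · rw [map_smul, norm_smul, norm_inv, Complex.norm_natCast]
    have := inv_lt_one_of_one_lt₀ h1
    nlinarith [norm_nonneg ((avg.{u} D i ^ r) (wordOp D u * star (wordOp D v)))]
  · rw [map_zero, norm_zero]; exact hε

theorem exists_avg_norm_lt_of_mem_algSpectral (hm : ∀ i, 1 < D.m i) (hD : D.LittlePullback)
    {x : CStarAlg.{u} D} (hx : x ∈ ⨆ n : {n : Fin k → ℤ // n ≠ 0}, algSpectral.{u} D n) {ε : ℝ}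
    (hε : 0 < ε) : ∃ S ∈ avgMonoid.{u} D, ‖S x‖ < ε := by
  -- The averages commute and are contractive, so the product of one that is good for x and one that
  -- is good for y is good for both.
  have hadd : ∀ x y : CStarAlg.{u} D, (∀ ε > 0, ∃ S ∈ avgMonoid.{u} D, ‖S x‖ < ε) →
      (∀ ε > 0, ∃ S ∈ avgMonoid.{u} D, ‖S y‖ < ε) →
      ∀ ε > 0, ∃ S ∈ avgMonoid.{u} D, ‖S (x + y)‖ < ε := by
    intro x y hx hy ε hε
    obtain ⟨S, hS, hx⟩ := hx (ε / 2) (by positivity)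
    obtain ⟨T, hT, hy⟩ := hy (ε / 2) (by positivity)
    refine ⟨S * T, mul_mem hS hT, ?_⟩
    have h1 := (norm_le_of_mem_avgMonoid hT (S x)).trans_lt hx
    have h2 := (norm_le_of_mem_avgMonoid hS (T y)).trans_lt hy
    rw [map_add]
    nth_rewrite 1 [avgMonoid_mul_comm hS hT]
    exact (norm_add_le _ _).trans_lt (by rw [Module.End.mul_apply, Module.End.mul_apply]; linarith)
  revert ε
  change ∀ ε > 0, _
  induction hx using Submodule.iSup_induction' with
  | mem n x hx =>
    obtain ⟨n, hn⟩ := n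
    dsimp only at hx
    induction hx using algSpectral_induction with
    | word u v h =>
      intro ε hε
      obtain ⟨i, hi⟩ := Function.ne_iff.1 hn
      obtain ⟨r, hr⟩ := exists_avg_pow_lt.{u} hm hD u v (i := i) (by
        intro h'; exact hi (by rw [← h i, h', sub_self]; rfl)) hε
      exact ⟨_, pow_mem (avg_mem i) r, hr⟩
    | zero => exact fun ε hε => ⟨1, one_mem _, by simpa using hε⟩
    | add x y _ _ hx hy => exact hadd x y hx hy
    | smul c x _ hx =>
      intro ε hε
      obtain ⟨S, hS, h⟩ := hx (ε / (‖c‖ + 1)) (by positivity)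
      refine ⟨S, hS, ?_⟩
      rw [map_smul, norm_smul]
      rw [lt_div_iff₀ (by positivity)] at h
      nlinarith [norm_nonneg (S x), norm_nonneg c]
  | zero => exact fun ε hε => ⟨1, one_mem _, by simpa using hε⟩
  | add x y _ _ hx hy => exact hadd x y hx hy

theorem exists_avg_eq_smul_one_of_mem_algSpectral_zero (hm : ∀ i, 1 < D.m i)
    {x : CStarAlg.{u} D} (hx : x ∈ algSpectral.{u} D 0) :
    ∃ S ∈ avgMonoid.{u} D, ∃ c : ℂ, S x = c • 1 := by
  induction hx using algSpectral_induction with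
  | word u v h =>
    induction u using path_induction generalizing v with
    | one =>
      have hv : v = 1 := by
        induction v using path_induction with
        | one => rfl
        | edge_mul i s w ih =>
          have := h i
          rw [deg_edge_mul_self, deg_one, Pi.zero_apply, Pi.zero_apply] at this
          omega
      subst hv
      exact ⟨1, one_mem _, 1, by simp⟩
    | edge_mul i s u ih =>
      have hi := h i
      rw [deg_edge_mul_self, Pi.zero_apply] at hi
      obtain ⟨t, v, rfl⟩ := exists_eq_edge_mul (w := v) (i := i) (by omega)
      obtain ⟨S, hS, c, hc⟩ := ih v fun j => by
        have := h j
        rw [deg_mul, deg_mul, deg_edge, deg_edge, Pi.add_apply, Pi.add_apply] at this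
        push_cast at this
        linarith
      refine ⟨S * avg D i, mul_mem hS (avg_mem i), if s = t then (D.m i : ℂ)⁻¹ * c else 0, ?_⟩
      rw [Module.End.mul_apply, avg_edge_edge]
      split_ifs
      · rw [map_smul, hc, smul_smul]
      · rw [map_zero, zero_smul]
  | zero => exact ⟨1, one_mem _, 0, by simp⟩
  | add x y _ _ hx hy =>
    obtain ⟨S, hS, c, hc⟩ := hx
    obtain ⟨T, hT, d, hd⟩ := hy
    refine ⟨S * T, mul_mem hS hT, c + d, ?_⟩
    rw [map_add]
    nth_rewrite 1 [avgMonoid_mul_comm hS hT]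
    rw [Module.End.mul_apply, Module.End.mul_apply, hc, hd, map_smul, map_smul,
      map_one_of_mem_avgMonoid hm hS, map_one_of_mem_avgMonoid hm hT, add_smul]
  | smul c x _ hx =>
    obtain ⟨S, hS, d, hd⟩ := hx
    exact ⟨S, hS, c * d, by rw [map_smul, hd, smul_smul]⟩

theorem exists_add_of_mem_iSup_algSpectral {b : CStarAlg.{u} D}
    (hb : b ∈ ⨆ n, algSpectral.{u} D n) : ∃ b₀ ∈ algSpectral.{u} D 0,
      ∃ b₁ ∈ ⨆ n : {n : Fin k → ℤ // n ≠ 0}, algSpectral.{u} D n, b₀ + b₁ = b := by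
  refine Submodule.mem_sup.1 ?_
  refine (iSup_le fun n => ?_ : (⨆ n, algSpectral.{u} D n) ≤ _) hb
  by_cases hn : n = 0
  · subst hn; exact le_sup_left
  · exact le_sup_of_le_right
      (le_iSup (fun n : {n : Fin k → ℤ // n ≠ 0} => algSpectral.{u} D n) ⟨n, hn⟩)

/-- Approximate x by b₀ + b₁ with b₀ of degree zero and b₁ of nonzero degrees. S makes b₀ scalar and
T makes b₁ small; T fixes the scalar, and S, which commutes with T, does not enlarge T b₁. -/
theorem exists_avg_norm_sub_smul_one_lt (hm : ∀ i, 1 < D.m i) (hD : D.LittlePullback)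
    (x : CStarAlg.{u} D) {ε : ℝ} (hε : 0 < ε) :
    ∃ S ∈ avgMonoid.{u} D, ∃ c : ℂ, ‖S x - c • 1‖ < ε := by
  obtain ⟨b, hb, hxb⟩ := exists_mem_iSup_algSpectral_norm_sub_lt x (half_pos hε)
  obtain ⟨b₀, hb₀, b₁, hb₁, rfl⟩ := exists_add_of_mem_iSup_algSpectral hb
  obtain ⟨S, hS, c, hc⟩ := exists_avg_eq_smul_one_of_mem_algSpectral_zero hm hb₀
  obtain ⟨T, hT, h⟩ := exists_avg_norm_lt_of_mem_algSpectral hm hD hb₁ (half_pos hε)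
  refine ⟨T * S, mul_mem hT hS, c, ?_⟩
  have e : (T * S) x - c • 1 = (T * S) (x - (b₀ + b₁)) + S (T b₁) := by
    have h0 : T (S b₀) = c • 1 := by rw [hc, map_smul, map_one_of_mem_avgMonoid hm hT]
    have h1 : T (S b₁) = S (T b₁) := LinearMap.congr_fun (avgMonoid_mul_comm hT hS) b₁
    simp only [Module.End.mul_apply, map_sub, map_add, h0, h1]
    abel
  rw [e]
  have h1 := (norm_le_of_mem_avgMonoid (mul_mem hT hS) (x - (b₀ + b₁))).trans_lt hxb
  have h2 := (norm_le_of_mem_avgMonoid hS (T b₁)).trans_lt h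
  exact (norm_add_le _ _).trans_lt (by linarith)

end SingleVertexGraph

/-! ### Averaging over a system of matrix units -/

section MatrixUnits

theorem sum_units_mul_units {n : ℕ} (a b : Fin n) :
    ∑ ε : Fin n → ℤˣ, ((ε a : ℤ) : ℂ) * ((ε b : ℤ) : ℂ) = if a = b then (2 : ℂ) ^ n else 0 := by
  split_ifs with h
  · subst h
    have : ∀ ε : Fin n → ℤˣ, ((ε a : ℤ) : ℂ) * ((ε a : ℤ) : ℂ) = 1 := fun ε => by
      rw [← Int.cast_mul, ← Units.val_mul, Int.units_mul_self]; simp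
    simp [this]
  -- Flipping the sign at a permutes the index set and negates every summand.
  · have key := Equiv.sum_comp (Equiv.mulLeft (Pi.mulSingle a (-1) : Fin n → ℤˣ))
      fun ε => ((ε a : ℤ) : ℂ) * ((ε b : ℤ) : ℂ)
    simp only [Equiv.coe_mulLeft, Pi.mul_apply, Pi.mulSingle_eq_same,
      Pi.mulSingle_eq_of_ne (Ne.symm h), one_mul, neg_mul, Units.val_neg, Int.cast_neg,
      Finset.sum_neg_distrib] at key
    exact self_eq_neg.1 key.symm

variable {A : Type*} [CStarAlgebra A] {n : ℕ}

/-- A system of `n × n` matrix units. -/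
structure IsMatrixUnits (e : Fin n → Fin n → A) : Prop where
  unit_mul : ∀ a b c d, e a b * e c d = if b = c then e a d else 0
  star_unit : ∀ a b, star (e a b) = e b a
  sum_unit : ∑ a, e a a = 1

/-- The signed permutation matrix with signs `ε` of the translation by `g`. -/
noncomputable def signedShift (e : Fin n → Fin n → A) (ε : Fin n → ℤˣ) (g : Fin n) : A :=
  ∑ a, ((ε a : ℤ) : ℂ) • e (a + g) a

theorem IsMatrixUnits.star_signedShift {e : Fin n → Fin n → A} (he : IsMatrixUnits e)
    (ε : Fin n → ℤˣ) (g : Fin n) :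
    star (signedShift e ε g) = ∑ a, ((ε a : ℤ) : ℂ) • e a (a + g) := by
  simp only [signedShift, star_sum, star_smul, he.star_unit]
  refine Finset.sum_congr rfl fun a _ => ?_
  simp

theorem IsMatrixUnits.signedShift_mem_unitary [NeZero n] {e : Fin n → Fin n → A}
    (he : IsMatrixUnits e) (ε : Fin n → ℤˣ) (g : Fin n) : signedShift e ε g ∈ unitary A := by
  have hsq : ∀ a, ((ε a : ℤ) : ℂ) * ((ε a : ℤ) : ℂ) = 1 := fun a => by
    rw [← Int.cast_mul, ← Units.val_mul, Int.units_mul_self]; simp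
  rw [Unitary.mem_iff, he.star_signedShift, signedShift]
  simp only [Finset.sum_mul, Finset.mul_sum, smul_mul_smul_comm, he.unit_mul, add_left_inj]
  constructor
  · simp [smul_ite, hsq, he.sum_unit]
  · simp only [smul_ite, smul_zero, Finset.sum_ite_eq', Finset.mem_univ,
      if_true, hsq, one_smul]
    rw [← he.sum_unit]
    exact Equiv.sum_comp (Equiv.addRight g) fun a => e a a

/-- Summing over the signs kills the terms with a ≠ b and multiplies the others by 2ⁿ; summing over
the translations then lets c = a + g run through all indices. -/
theorem IsMatrixUnits.sum_signedShift {e : Fin n → Fin n → A} (he : IsMatrixUnits e) [NeZero n]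
    (x : A) : ∑ p : (Fin n → ℤˣ) × Fin n, signedShift e p.1 p.2 * x * star (signedShift e p.1 p.2)
      = (2 : ℂ) ^ n • ∑ a, ∑ c, e c a * x * e a c := by
  have h1 : ∀ p : (Fin n → ℤˣ) × Fin n,
      signedShift e p.1 p.2 * x * star (signedShift e p.1 p.2)
        = ∑ a, ∑ b, (((p.1 a : ℤ) : ℂ) * ((p.1 b : ℤ) : ℂ)) • (e (a + p.2) a * x * e b (b + p.2)) := by
    intro p
    rw [he.star_signedShift, signedShift, Finset.sum_mul, Finset.sum_mul]
    refine Finset.sum_congr rfl fun a _ => ?_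
    rw [Finset.mul_sum]
    refine Finset.sum_congr rfl fun b _ => ?_
    rw [smul_mul_assoc, smul_mul_smul_comm]
  simp only [h1]
  rw [Fintype.sum_prod_type_right]
  have h2 : ∀ g : Fin n, ∑ ε : Fin n → ℤˣ, ∑ a, ∑ b, (((ε a : ℤ) : ℂ) * ((ε b : ℤ) : ℂ)) •
      (e (a + g) a * x * e b (b + g)) = (2 : ℂ) ^ n • ∑ a, e (a + g) a * x * e a (a + g) := by
    intro g
    rw [Finset.sum_comm, Finset.smul_sum]
    refine Finset.sum_congr rfl fun a _ => ?_
    rw [Finset.sum_comm]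
    simp only [← Finset.sum_smul, sum_units_mul_units, ite_smul, zero_smul, Finset.sum_ite_eq,
      Finset.mem_univ, if_true]
  simp only [h2]
  rw [← Finset.smul_sum, Finset.sum_comm]
  congr 1
  refine Finset.sum_congr rfl fun a _ => ?_
  exact Equiv.sum_comp (Equiv.addLeft a) fun c => e c a * x * e a c

theorem IsMatrixUnits.mem_averagingOperators [NeZero n] {e : Fin n → Fin n → A}
    (he : IsMatrixUnits e) :
    (fun x => (n : ℂ)⁻¹ • ∑ a, ∑ c, e c a * x * e a c) ∈ averagingOperators A ⊤ := by
  let G := (Fin n → ℤˣ) × Fin n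
  let f : G ≃ Fin (Fintype.card G) := Fintype.equivFin G
  have hcard : Fintype.card G = 2 ^ n * n := by simp [G]
  have hpos : (0 : ℝ) < Fintype.card G := by exact_mod_cast Fintype.card_pos
  refine ⟨Fintype.card G, fun j => ⟨_, he.signedShift_mem_unitary (f.symm j).1 (f.symm j).2⟩,
    fun _ => (Fintype.card G : ℝ)⁻¹, fun _ => Subgroup.mem_top _, fun _ => by positivity, ?_,
    fun x => ?_⟩
  · rw [Finset.sum_const, Finset.card_univ, Fintype.card_fin, nsmul_eq_mul,
      mul_inv_cancel₀ hpos.ne']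
  · rw [← Finset.smul_sum, Equiv.sum_comp f.symm fun p =>
      signedShift e p.1 p.2 * x * star (signedShift e p.1 p.2), he.sum_signedShift, smul_smul]
    rw [hcard]
    have : (n : ℂ) ≠ 0 := Nat.cast_ne_zero.2 (NeZero.ne n)
    push_cast
    field_simp

end MatrixUnits

/-- The endomorphism `x ↦ ∑ V_a x V_a⋆` defined by a tuple of Cuntz type. -/
noncomputable def IsCuntzTuple.endo {A : Type*} [CStarAlgebra A] {n : ℕ} {V : Fin n → A}
    (hV : IsCuntzTuple V) : A →⋆ₐ[ℂ] A where
  toFun x := ∑ a, V a * x * star (V a)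
  map_one' := by simp [hV.2]
  map_mul' x y := by
    rw [Finset.sum_mul_sum]
    refine Finset.sum_congr rfl fun a _ => ?_
    have h : ∀ b, V a * x * star (V a) * (V b * y * star (V b))
        = if a = b then V a * (x * y) * star (V b) else 0 := fun b => by
      have : V a * x * star (V a) * (V b * y * star (V b))
        = V a * x * (star (V a) * V b) * y * star (V b) := by simp only [mul_assoc]
      rw [this, hV.1]
      split_ifs <;> simp [mul_assoc]
    simp [h]
  map_zero' := by simp
  map_add' x y := by simp [mul_add, add_mul, Finset.sum_add_distrib]
  commutes' c := by
    simp only [← Algebra.commutes c (V _), mul_assoc, ← Finset.mul_sum, hV.2, mul_one]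
  map_star' x := by simp [star_sum, mul_assoc]

theorem IsCuntzTuple.endo_apply {A : Type*} [CStarAlgebra A] {n : ℕ} {V : Fin n → A}
    (hV : IsCuntzTuple V) (x : A) : hV.endo x = ∑ a, V a * x * star (V a) := rfl

/-- A unital star endomorphism fixes scalars and is contractive, so an approximation by a scalar
survives it. -/
theorem IsCuntzTuple.norm_endo_sub_smul_one_le {A : Type*} [CStarAlgebra A] {n : ℕ} {V : Fin n → A}
    (hV : IsCuntzTuple V) (x : A) (c : ℂ) : ‖hV.endo x - c • 1‖ ≤ ‖x - c • 1‖ := by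
  have h : hV.endo x - c • 1 = hV.endo (x - c • 1) := by rw [map_sub, map_smul, map_one]
  rw [h]
  exact NonUnitalStarAlgHom.norm_apply_le _ _

theorem IsCuntzTuple.mul {A : Type*} [CStarAlgebra A] {n p : ℕ} {V : Fin n → A} {W : Fin p → A}
    (hV : IsCuntzTuple V) (hW : IsCuntzTuple W) :
    IsCuntzTuple fun c => V (finProdFinEquiv.symm c).1 * W (finProdFinEquiv.symm c).2 := by
  constructor
  · intro c d
    obtain ⟨⟨a, b⟩, rfl⟩ := finProdFinEquiv.surjective c
    obtain ⟨⟨a', b'⟩, rfl⟩ := finProdFinEquiv.surjective d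
    simp only [Equiv.symm_apply_apply, star_mul, EmbeddingLike.apply_eq_iff_eq, Prod.mk.injEq]
    rw [mul_assoc, ← mul_assoc (star (V a)), hV.1]
    by_cases h : a = a'
    · simp [h, hW.1]
    · simp [h]
  · rw [Equiv.sum_comp finProdFinEquiv.symm fun q => V q.1 * W q.2 * star (V q.1 * W q.2),
      Fintype.sum_prod_type, ← hV.2]
    refine Finset.sum_congr rfl fun a _ => ?_
    have : ∀ b, V a * W b * star (V a * W b) = V a * (W b * star (W b)) * star (V a) := fun b => by
      simp only [star_mul, mul_assoc]
    simp only [this, ← Finset.sum_mul, ← Finset.mul_sum, hW.2, mul_one]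

namespace SingleVertexGraph

variable {k : ℕ} {D : SingleVertexGraph k}

/-! ### Families of words of Cuntz type -/

/-- A nonempty family of words of the same degree which is of Cuntz type in `𝒪_θ`. -/
structure IsWordFamily (p : Fin k → ℕ) {n : ℕ} (V : Fin n → D.Path) : Prop where
  ne_zero : n ≠ 0
  deg : ∀ a, D.deg (V a) = p
  cuntz : IsCuntzTuple fun a => wordOp.{u} D (V a)

theorem IsWordFamily.mul {p q : Fin k → ℕ} {n n' : ℕ} {V : Fin n → D.Path} {W : Fin n' → D.Path}
    (hV : IsWordFamily.{u} p V) (hW : IsWordFamily.{u} q W) :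
    IsWordFamily.{u} (p + q)
      fun c => V (finProdFinEquiv.symm c).1 * W (finProdFinEquiv.symm c).2 where
  ne_zero := mul_ne_zero hV.ne_zero hW.ne_zero
  deg c := by rw [deg_mul, hV.deg, hW.deg]
  cuntz := by
    simp only [map_mul]
    exact hV.cuntz.mul hW.cuntz

theorem isWordFamily_one : IsWordFamily.{u} (D := D) 0 (fun _ : Fin 1 => 1) where
  ne_zero := one_ne_zero
  deg _ := deg_one
  cuntz := ⟨fun a b => by simp [Subsingleton.elim a b], by simp⟩

theorem isWordFamily_edge (hm : ∀ i, 1 < D.m i) (i : Fin k) :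
    IsWordFamily.{u} (Pi.single i 1) (D.edge i) where
  ne_zero := by have := hm i; omega
  deg _ := rfl
  cuntz := (isCuntzRep_gen D).cuntz i

theorem exists_isWordFamily (hm : ∀ i, 1 < D.m i) (z : D.Path) :
    ∃ (n : ℕ) (V : Fin n → D.Path), IsWordFamily.{u} (D.deg z) V := by
  induction z using path_induction with
  | one => exact ⟨1, _, deg_one (D := D) ▸ isWordFamily_one⟩
  | edge_mul i s w ih =>
    obtain ⟨n, V, hV⟩ := ih
    exact ⟨_, _, by rw [deg_mul]; exact (isWordFamily_edge hm i).mul hV⟩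

theorem exists_isWordFamily_of_mem_avgMonoid (hm : ∀ i, 1 < D.m i)
    {S : Module.End ℂ (CStarAlg.{u} D)} (hS : S ∈ avgMonoid D) :
    ∃ (p : Fin k → ℕ) (n : ℕ) (V : Fin n → D.Path), IsWordFamily.{u} p V ∧
      ∀ x, S x = (n : ℂ)⁻¹ • ∑ a, star (wordOp D (V a)) * x * wordOp D (V a) := by
  induction hS using Submonoid.closure_induction with
  | mem S hS =>
    obtain ⟨i, rfl⟩ := hS
    exact ⟨_, _, _, isWordFamily_edge hm i, avg_apply i⟩
  | one => exact ⟨_, _, _, isWordFamily_one, fun x => by simp⟩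
  | mul S T _ _ hS hT =>
    obtain ⟨p, n, V, hV, hS⟩ := hS
    obtain ⟨q, n', W, hW, hT⟩ := hT
    -- In S (T x) the words of T stand next to x: V⋆ (W⋆ x W) V = (W V)⋆ x (W V), whence the
    -- reversed order.
    refine ⟨_, _, _, hW.mul hV, fun x => ?_⟩
    rw [Equiv.sum_comp finProdFinEquiv.symm fun c => star (wordOp.{u} D (W c.1 * V c.2)) * x
      * wordOp D (W c.1 * V c.2), Fintype.sum_prod_type_right, Module.End.mul_apply, hS, hT,
      Nat.cast_mul, mul_inv, mul_comm, mul_smul]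
    simp only [mul_smul_comm, smul_mul_assoc, ← Finset.smul_sum, map_mul, star_mul,
      Finset.mul_sum, Finset.sum_mul, mul_assoc]

/-- The matrix units of a family of words, in a subalgebra containing the degree zero part. -/
noncomputable def matrixUnit {n : ℕ} (V : Fin n → D.Path) {p : Fin k → ℕ}
    (hV : IsWordFamily.{u} p V) (𝒜 : StarSubalgebra ℂ (CStarAlg.{u} D))
    (hX : (algSpectral.{u} D 0 : Set (CStarAlg.{u} D)) ⊆ 𝒜) (a b : Fin n) : 𝒜 :=
  ⟨wordOp D (V a) * star (wordOp D (V b)),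
    hX (wordOp_mul_star_mem fun i => by rw [hV.deg, hV.deg, sub_self]; rfl)⟩

theorem isMatrixUnits_matrixUnit {n : ℕ} {V : Fin n → D.Path} {p : Fin k → ℕ}
    (hV : IsWordFamily.{u} p V) (𝒜 : StarSubalgebra ℂ (CStarAlg.{u} D))
    [IsClosed (𝒜 : Set (CStarAlg.{u} D))]
    (hX : (algSpectral.{u} D 0 : Set (CStarAlg.{u} D)) ⊆ 𝒜) :
    IsMatrixUnits (matrixUnit V hV 𝒜 hX) where
  unit_mul a b c d := by
    refine Subtype.ext ?_
    have h : wordOp D (V a) * star (wordOp D (V b)) * (wordOp D (V c) * star (wordOp D (V d)))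
      = wordOp D (V a) * (star (wordOp.{u} D (V b)) * wordOp D (V c)) * star (wordOp D (V d)) := by
      simp only [mul_assoc]
    refine h.trans ?_
    rw [hV.cuntz.1]
    split_ifs
    · rw [mul_one]; rfl
    · rw [mul_zero, zero_mul]; rfl
  star_unit a b := by
    refine Subtype.ext ?_
    change star (wordOp.{u} D (V a) * star (wordOp D (V b))) = _
    rw [star_mul, star_star]; rfl
  sum_unit := by
    refine Subtype.ext ?_
    rw [AddSubmonoidClass.coe_finsetSum]
    exact hV.cuntz.2

/-! ### The Dixmier property -/

theorem hasDixmierProperty (hm : ∀ i, 1 < D.m i) (hD : D.LittlePullback)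
    (𝒜 : StarSubalgebra ℂ (CStarAlg.{u} D)) [IsClosed (𝒜 : Set (CStarAlg.{u} D))]
    (hX : (algSpectral.{u} D 0 : Set (CStarAlg.{u} D)) ⊆ 𝒜) : HasDixmierProperty 𝒜 := by
  have : Nontrivial (CStarAlg.{u} D) := nontrivial_cstarAlg fun i => (hm i).trans' zero_lt_one
  intro a
  -- The bound on c is recorded for the compactness argument that extracts a limit scalar.
  have key : ∀ ε > 0, ∃ α ∈ averagingOperators 𝒜 ⊤, ∃ c : ℂ, ‖c‖ ≤ ‖a‖ + ε ∧
      ‖α a - c • 1‖ < ε := by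
    intro ε hε
    obtain ⟨S, hS, c, hc⟩ := exists_avg_norm_sub_smul_one_lt hm hD (a : CStarAlg.{u} D) hε
    obtain ⟨p, n, V, hV, hSV⟩ := exists_isWordFamily_of_mem_avgMonoid hm hS
    have : NeZero n := ⟨hV.ne_zero⟩
    refine ⟨_, (isMatrixUnits_matrixUnit hV 𝒜 hX).mem_averagingOperators, c, ?_, ?_⟩
    · have h1 : ‖c • (1 : CStarAlg.{u} D)‖ = ‖c‖ := by rw [norm_smul, CStarRing.norm_one, mul_one]
      have h2 := norm_le_of_mem_avgMonoid hS (a : CStarAlg.{u} D)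
      have h3 := norm_sub_norm_le (c • (1 : CStarAlg.{u} D)) (S a)
      rw [norm_sub_rev, h1] at h3
      have h4 : ‖(a : CStarAlg.{u} D)‖ = ‖a‖ := rfl
      linarith
    -- Conjugating V_d⋆ a V_d by V_b gives (V_b V_d⋆) a (V_d V_b⋆): the unitary average is S
    -- followed by the endomorphism of the word family.
    · have e : (((n : ℂ)⁻¹ • ∑ b, ∑ d, matrixUnit V hV 𝒜 hX d b * a * matrixUnit V hV 𝒜 hX b d : 𝒜) :
          CStarAlg.{u} D) = hV.cuntz.endo (S a) := by
        rw [IsCuntzTuple.endo_apply, hSV, Finset.sum_comm, SetLike.val_smul,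
          AddSubmonoidClass.coe_finsetSum]
        simp only [AddSubmonoidClass.coe_finsetSum, mul_smul_comm, smul_mul_assoc,
          ← Finset.smul_sum, Finset.mul_sum, Finset.sum_mul]
        congr 1
        refine Finset.sum_congr rfl fun b _ => Finset.sum_congr rfl fun d _ => ?_
        change wordOp D (V b) * star (wordOp D (V d)) * (a : CStarAlg.{u} D)
          * (wordOp D (V d) * star (wordOp D (V b))) = _
        simp only [mul_assoc]
      refine ((hV.cuntz.norm_endo_sub_smul_one_le (S a) c).trans_lt hc).trans_le' (le_of_eq ?_)
      rw [← e]
      rfl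
  choose! α hα c hc hαc using key
  let ε : ℕ → ℝ := fun n => 1 / ((n : ℝ) + 1)
  have hε : ∀ n, 0 < ε n := fun n => Nat.one_div_pos_of_nat
  have hε1 : ∀ n, ε n ≤ 1 := fun n => by
    simp only [ε]
    rw [div_le_one (by positivity)]
    linarith [(Nat.cast_nonneg n : (0 : ℝ) ≤ n)]
  have hlim : Filter.Tendsto ε Filter.atTop (nhds 0) := tendsto_one_div_add_atTop_nhds_zero_nat
  -- The scalars for the tolerances 1/(n+1) stay in a disc of radius ‖a‖ + 1, so a subsequence
  -- converges; the averages along it converge to the same scalar.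
  obtain ⟨l, -, φ, hφ, hl⟩ := tendsto_subseq_of_bounded
    (Metric.isBounded_closedBall (x := (0 : ℂ)) (r := ‖a‖ + 1)) (x := fun n => c (ε n)) (fun n => by
      rw [mem_closedBall_zero_iff]
      linarith [hc (ε n) (hε n), hε1 n])
  refine ⟨l • 1, ?_, ?_⟩
  · refine mem_closure_of_tendsto (f := fun n => α (ε (φ n)) a) (b := Filter.atTop) ?_
      (.of_forall fun n => ⟨_, hα _ (hε _), rfl⟩)
    have h1 : Filter.Tendsto (fun n => α (ε (φ n)) a - c (ε (φ n)) • 1) Filter.atTop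
        (nhds (0 : 𝒜)) :=
      squeeze_zero_norm (fun n => (hαc _ (hε (φ n))).le) (hlim.comp hφ.tendsto_atTop)
    have h2 : Filter.Tendsto (fun n => c (ε (φ n)) • (1 : 𝒜)) Filter.atTop (nhds (l • (1 : 𝒜))) :=
      hl.smul_const _
    simpa using h1.add h2
  · rw [← Algebra.algebraMap_eq_smul_one]
    exact Semigroup.mem_center_iff.2 fun g => (Algebra.commutes l g).symm

end SingleVertexGraph

/-! ### Integrals of positive functions -/

section IntegralPositive

open MeasureTheory

/-- Near x₀ the integrand stays within half of ‖f x₀‖ of f x₀, so its integral over that open set is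
nonzero. The full integral dominates this one in the order, hence also in norm. -/
theorem integral_star_mul_self_ne_zero {X A : Type*} [TopologicalSpace X] [CompactSpace X]
    [MeasurableSpace X] [BorelSpace X] [CStarAlgebra A] (μ : Measure X) [IsFiniteMeasure μ]
    [μ.IsOpenPosMeasure] {g : X → A} (hg : Continuous g) {x₀ : X} (hx₀ : g x₀ ≠ 0) :
    ∫ x, star (g x) * g x ∂μ ≠ 0 := by
  let _ := CStarAlgebra.spectralOrder A
  have := CStarAlgebra.spectralOrderedRing A
  set f : X → A := fun x => star (g x) * g x with hf
  have hfc : Continuous f := by fun_prop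
  have hf0 : ∀ x, 0 ≤ f x := fun x => star_mul_self_nonneg (g x)
  have hfi : Integrable f μ := hfc.integrable_of_hasCompactSupport (.of_compactSpace f)
  have hc : 0 < ‖f x₀‖ := norm_pos_iff.2 (by simpa [hf, CStarRing.star_mul_self_eq_zero_iff])
  let U : Set X := {x | ‖f x - f x₀‖ < ‖f x₀‖ / 2}
  have hU : IsOpen U := isOpen_lt (by fun_prop) continuous_const
  have hμU : 0 < μ.real U := by
    rw [Measure.real, ENNReal.toReal_pos_iff]
    exact ⟨hU.measure_pos μ ⟨x₀, by simpa [U] using hc⟩, measure_lt_top μ U⟩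
  have h1 : ‖∫ x in U, f x ∂μ‖ ≤ ‖∫ x, f x ∂μ‖ :=
    CStarAlgebra.norm_le_norm_of_nonneg_of_le (integral_nonneg hf0)
      (integral_mono_measure Measure.restrict_le_self (.of_forall hf0) hfi)
  have h2 : ‖(∫ x in U, f x ∂μ) - μ.real U • f x₀‖ ≤ ‖f x₀‖ / 2 * μ.real U := by
    rw [← setIntegral_const, ← integral_sub hfi.integrableOn (integrable_const _)]
    exact norm_setIntegral_le_of_norm_le_const (measure_lt_top μ U) fun x hx => le_of_lt hx
  have h3 : ‖μ.real U • f x₀‖ = μ.real U * ‖f x₀‖ := by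
    rw [norm_smul, Real.norm_of_nonneg hμU.le]
  have h4 := norm_sub_norm_le (μ.real U • f x₀) (∫ x in U, f x ∂μ)
  rw [norm_sub_rev, h3] at h4
  refine norm_pos_iff.1 (lt_of_lt_of_le ?_ h1)
  nlinarith [mul_pos hμU hc]

end IntegralPositive

namespace SingleVertexGraph

open UnitAddTorus MeasureTheory

variable {k : ℕ} {D : SingleVertexGraph k}

/-! ### The gauge action -/

theorem mFourier_mul_star_self (n : Fin k → ℤ) (x : UnitAddTorus (Fin k)) :
    mFourier n x * star (mFourier n x) = 1 := by
  have h : star (mFourier n x) = mFourier (-n) x := mFourier_neg.symm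
  rw [h, ← mFourier_add, add_neg_cancel, mFourier_zero]; rfl

theorem IsCuntzRep.gauge {A : Type*} [CStarAlgebra A] {E : ∀ i : Fin k, Fin (D.m i) → A}
    (hE : D.IsCuntzRep E) (x : UnitAddTorus (Fin k)) :
    D.IsCuntzRep fun i s => mFourier (Pi.single i 1) x • E i s where
  comm i j hij s t := by
    rw [smul_mul_smul_comm, smul_mul_smul_comm, hE.comm, mul_comm]
  cuntz i := by
    constructor
    · intro s t
      rw [star_smul, smul_mul_smul_comm, (hE.cuntz i).1, mul_comm, mFourier_mul_star_self, one_smul]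
    · simp only [star_smul, smul_mul_smul_comm, mFourier_mul_star_self, one_smul, (hE.cuntz i).2]

/-- The twist of a representation by a point of the torus. -/
@[reducible]
noncomputable def CuntzRep.gauge (ρ : CuntzRep.{u} D) (x : UnitAddTorus (Fin k)) :
    CuntzRep.{u} D where
  carrier := ρ.carrier
  E i s := mFourier (Pi.single i 1) x • ρ.E i s
  isRep := ρ.isRep.gauge x

variable (D) in
/-- The gauge action on `𝒪_θ`, with values in the product of all representations. -/
noncomputable def gauge (x : UnitAddTorus (Fin k)) : CStarAlg.{u} D →⋆ₐ[ℂ] RepProd.{u} D :=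
  StarAlgHom.comp
    { toFun := fun y => ⟨fun ρ => y (ρ.gauge x), memℓp_infty ⟨‖y‖, by
        rintro _ ⟨ρ, rfl⟩
        exact lp.norm_apply_le_norm ENNReal.top_ne_zero y (ρ.gauge x)⟩⟩
      map_one' := rfl
      map_mul' := fun _ _ => rfl
      map_zero' := rfl
      map_add' := fun _ _ => rfl
      commutes' := fun _ => rfl
      map_star' := fun _ => rfl } (toProd D)

theorem gauge_gen (x : UnitAddTorus (Fin k)) (i : Fin k) (s : Fin (D.m i)) :
    gauge.{u} D x (gen D i s) = mFourier (Pi.single i 1) x • toProd D (gen D i s) := rfl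

theorem gauge_wordOp (x : UnitAddTorus (Fin k)) (w : D.Path) :
    gauge.{u} D x (wordOp D w)
      = mFourier (fun i => (D.deg w i : ℤ)) x • toProd D (wordOp D w) := by
  induction w using path_induction with
  | one =>
    have : (fun i => ((D.deg 1 i : ℕ) : ℤ)) = 0 := by rw [deg_one]; rfl
    rw [this, mFourier_zero]
    simp
  | edge_mul i s w ih =>
    have : (fun j => ((D.deg (D.edge i s * w) j : ℕ) : ℤ))
        = Pi.single i 1 + fun j => (D.deg w j : ℤ) := by
      funext j
      simp only [deg_mul, deg_edge, Pi.add_apply, Pi.single_apply]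
      push_cast
      ring
    rw [this, mFourier_add, wordOp_edge_mul, map_mul, map_mul, ih, gauge_gen, smul_mul_smul_comm]

theorem gauge_of_mem_algSpectral {n : Fin k → ℤ} {b : CStarAlg.{u} D}
    (hb : b ∈ algSpectral.{u} D n) (x : UnitAddTorus (Fin k)) :
    gauge D x b = mFourier n x • toProd D b := by
  induction hb using algSpectral_induction with
  | word u v h =>
    have hn : n = (fun i => (D.deg u i : ℤ)) + -fun i => (D.deg v i : ℤ) := by
      funext i
      rw [← h i]; rfl
    rw [map_mul, map_star, gauge_wordOp, gauge_wordOp, map_mul, map_star, star_smul,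
      smul_mul_smul_comm, hn, mFourier_add, mFourier_neg]
    rfl
  | zero => rw [map_zero, map_zero, smul_zero]
  | add b c _ _ hb hc => rw [map_add, map_add, hb, hc, smul_add]
  | smul c b _ hb => rw [map_smul, map_smul, hb, smul_comm]

theorem norm_gauge_le (x : UnitAddTorus (Fin k)) (b : CStarAlg.{u} D) : ‖gauge D x b‖ ≤ ‖b‖ :=
  NonUnitalStarAlgHom.norm_apply_le _ _

/-- On each spectral subspace the character is 1 at the origin; density and contractivity do the
rest. -/
theorem gauge_zero (b : CStarAlg.{u} D) : gauge D 0 b = toProd D b := by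
  have h : ∀ ε > 0, ‖gauge D 0 b - toProd D b‖ ≤ ε := by
    intro ε hε
    obtain ⟨c, hc, hbc⟩ := exists_mem_iSup_algSpectral_norm_sub_lt b (half_pos hε)
    have h0 : gauge D 0 c = toProd D c := by
      clear hbc
      induction hc using Submodule.iSup_induction' with
      | mem n c hc =>
        rw [gauge_of_mem_algSpectral hc]
        have : mFourier n (0 : UnitAddTorus (Fin k)) = 1 := by simp [mFourier]
        rw [this, one_smul]
      | zero => rw [map_zero, map_zero]
      | add b c _ _ hb hc => rw [map_add, map_add, hb, hc]
    have e : gauge D 0 b - toProd D b = gauge D 0 (b - c) - toProd D (b - c) := by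
      rw [map_sub, map_sub, h0]; abel
    rw [e]
    have h1 := norm_gauge_le 0 (b - c)
    have h2 := norm_toProd (b - c)
    refine (norm_sub_le _ _).trans ?_
    linarith
  exact sub_eq_zero.1 (norm_le_zero_iff.1 (le_of_forall_pos_le_add fun ε hε => by
    simpa using h ε hε))

theorem continuous_gauge (b : CStarAlg.{u} D) : Continuous fun x => gauge D x b := by
  refine continuous_of_uniform_approx_of_continuous fun V hV => ?_
  obtain ⟨ε, hε, hεV⟩ := Metric.mem_uniformity_dist.1 hV
  obtain ⟨c, hc, hbc⟩ := exists_mem_iSup_algSpectral_norm_sub_lt b hε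
  refine ⟨fun x => gauge D x c, ?_, fun x => hεV ?_⟩
  · clear hbc
    induction hc using Submodule.iSup_induction' with
    | mem n c hc =>
      simp only [gauge_of_mem_algSpectral hc]
      exact (mFourier n).continuous.smul continuous_const
    | zero => simp only [map_zero]; exact continuous_const
    | add b c _ _ hb hc => simp only [map_add]; exact hb.add hc
  · rw [dist_eq_norm, ← map_sub]
    exact (norm_gauge_le x _).trans_lt hbc

/-- The normalised Haar measure on the torus. -/
noncomputable abbrev torusMeasure (k : ℕ) : Measure (UnitAddTorus (Fin k)) :=
  Measure.pi fun _ => AddCircle.haarAddCircle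

theorem integral_mFourier {n : Fin k → ℤ} (hn : n ≠ 0) :
    ∫ x, mFourier n x ∂torusMeasure k = 0 := by
  obtain ⟨i, hi⟩ := Function.ne_iff.1 hn
  simp only [mFourier, ContinuousMap.coe_mk]
  rw [MeasureTheory.integral_fintype_prod_eq_prod (𝕜 := ℂ)
    (f := fun i (y : UnitAddCircle) => fourier (n i) y)]
  refine Finset.prod_eq_zero (Finset.mem_univ i) ?_
  -- A nontrivial character of the circle changes sign under a suitable translation.
  exact integral_eq_zero_of_add_right_eq_neg (fourier_add_half_inv_index hi one_pos)

variable (D) in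
/-- The average of the gauge action. -/
noncomputable def gaugeIntegral (b : CStarAlg.{u} D) : RepProd.{u} D :=
  ∫ x, gauge D x b ∂torusMeasure k

theorem integrable_gauge (b : CStarAlg.{u} D) :
    Integrable (fun x => gauge D x b) (torusMeasure k) :=
  (continuous_gauge b).integrable_of_hasCompactSupport (.of_compactSpace _)

theorem gaugeIntegral_add (b c : CStarAlg.{u} D) :
    gaugeIntegral D (b + c) = gaugeIntegral D b + gaugeIntegral D c := by
  simp only [gaugeIntegral, map_add]
  exact integral_add (integrable_gauge b) (integrable_gauge c)

theorem norm_gaugeIntegral_le (b : CStarAlg.{u} D) : ‖gaugeIntegral D b‖ ≤ ‖b‖ := by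
  have := norm_integral_le_of_norm_le_const (μ := torusMeasure k)
    (.of_forall fun x => norm_gauge_le x b)
  simpa [gaugeIntegral] using this

theorem gaugeIntegral_of_mem_zero {b : CStarAlg.{u} D} (hb : b ∈ algSpectral.{u} D 0) :
    gaugeIntegral D b = toProd D b := by
  simp [gaugeIntegral, gauge_of_mem_algSpectral hb, mFourier_zero]

theorem gaugeIntegral_of_mem_iSup {b : CStarAlg.{u} D}
    (hb : b ∈ ⨆ n : {n : Fin k → ℤ // n ≠ 0}, algSpectral.{u} D n) : gaugeIntegral D b = 0 := by
  induction hb using Submodule.iSup_induction' with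
  | mem n b hb =>
    simp only [gaugeIntegral, gauge_of_mem_algSpectral hb]
    rw [integral_smul_const, integral_mFourier n.2, zero_smul]
  | zero => simp [gaugeIntegral]
  | add b c _ _ hb hc => rw [gaugeIntegral_add, hb, hc, add_zero]

/-- Faithfulness on positive elements: the integrand is continuous, of the form g⋆ g, and g does not
vanish at the origin of the torus, where the gauge action is the inclusion. -/
theorem gaugeIntegral_star_mul_self_ne_zero {b : CStarAlg.{u} D} (hb : b ≠ 0) :
    gaugeIntegral D (star b * b) ≠ 0 := by
  simp only [gaugeIntegral, map_mul, map_star]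
  refine integral_star_mul_self_ne_zero _ (continuous_gauge b) (x₀ := 0) ?_
  rw [gauge_zero, ← norm_ne_zero_iff, norm_toProd]
  exact norm_ne_zero_iff.2 hb

theorem norm_gaugeIntegral_sub_le (b c : CStarAlg.{u} D) :
    ‖gaugeIntegral D b‖ ≤ ‖gaugeIntegral D c‖ + ‖b - c‖ := by
  have h := gaugeIntegral_add c (b - c)
  rw [add_sub_cancel] at h
  rw [h]
  refine (norm_add_le _ _).trans ?_
  gcongr
  exact norm_gaugeIntegral_le _

end SingleVertexGraph

/-! ### Matrices in an algebra with a tuple of Cuntz type -/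

section MatrixHom

open scoped Matrix.Norms.L2Operator

variable {A : Type*} [CStarAlgebra A] {n : ℕ} {V : Fin n → A}

theorem IsCuntzTuple.star_sum_mul_sum (hV : IsCuntzTuple V) (x y : Fin n → ℂ) :
    star (∑ a, y a • V a) * ∑ a, x a • V a = (∑ a, star (y a) * x a) • (1 : A) := by
  simp only [star_sum, star_smul, Finset.sum_mul, Finset.mul_sum, smul_mul_smul_comm, hV.1,
    smul_ite, smul_zero, Finset.sum_ite_eq', Finset.mem_univ, if_true, Finset.sum_smul]

/-- The star homomorphism from matrices sending the matrix units to `V_a V_b⋆`. -/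
noncomputable def IsCuntzTuple.matrixHom (hV : IsCuntzTuple V) :
    Matrix (Fin n) (Fin n) ℂ →⋆ₐ[ℂ] A where
  toFun c := ∑ a, ∑ b, c a b • (V a * star (V b))
  map_one' := by simp [Matrix.one_apply, ite_smul, hV.2]
  map_mul' c d := by
    have h : ∀ a b a' b', (c a b • (V a * star (V b))) * (d a' b' • (V a' * star (V b')))
        = if b = a' then (c a b * d a' b') • (V a * star (V b')) else 0 := by
      intro a b a' b'
      have : V a * star (V b) * (V a' * star (V b')) = V a * (star (V b) * V a') * star (V b') := by
        simp only [mul_assoc]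
      rw [smul_mul_smul_comm, this, hV.1]
      split_ifs <;> simp
    have h2 : ∀ a b, ∑ a', ∑ b', (c a b • (V a * star (V b))) * (d a' b' • (V a' * star (V b')))
        = ∑ b', (c a b * d b b') • (V a * star (V b')) := by
      intro a b
      simp only [h]
      rw [Finset.sum_eq_single b (fun a' _ ha' => by simp [Ne.symm ha']) (by simp)]
      simp
    rw [Finset.sum_mul]
    refine Finset.sum_congr rfl fun a _ => ?_
    simp only [Finset.sum_mul]
    simp only [Finset.mul_sum, h2, Matrix.mul_apply, Finset.sum_smul]
    exact Finset.sum_comm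
  map_zero' := by simp
  map_add' c d := by simp [add_smul, Finset.sum_add_distrib]
  commutes' c := by
    simp [Matrix.algebraMap_matrix_apply, ite_smul, ← Finset.smul_sum, hV.2,
      Algebra.algebraMap_eq_smul_one]
  map_star' c := by
    simp only [star_sum, star_smul, star_mul, star_star, Matrix.star_apply]
    exact Finset.sum_comm

theorem IsCuntzTuple.matrixHom_apply (hV : IsCuntzTuple V) (c : Matrix (Fin n) (Fin n) ℂ) :
    hV.matrixHom c = ∑ a, ∑ b, c a b • (V a * star (V b)) := rfl

theorem IsCuntzTuple.matrixHom_mul_sum (hV : IsCuntzTuple V) (c : Matrix (Fin n) (Fin n) ℂ)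
    (x : Fin n → ℂ) :
    hV.matrixHom c * ∑ a, x a • V a = ∑ a, (c.mulVec x) a • V a := by
  simp only [hV.matrixHom_apply, Finset.sum_mul, Finset.mul_sum, smul_mul_smul_comm, mul_assoc,
    hV.1, mul_ite, mul_one, mul_zero, smul_ite, smul_zero, Matrix.mulVec, dotProduct,
    Finset.sum_smul, Finset.sum_ite_eq', Finset.mem_univ, if_true]
  exact Finset.sum_comm

theorem IsCuntzTuple.norm_sum_smul_le (hV : IsCuntzTuple V) (x : EuclideanSpace ℂ (Fin n)) :
    ‖∑ a, x a • V a‖ ≤ ‖x‖ := by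
  have h1 := CStarRing.norm_star_mul_self (x := ∑ a, x a • V a)
  have h2 : ∑ a, star (x a) * x a = ((‖x‖ ^ 2 : ℝ) : ℂ) := by
    rw [EuclideanSpace.norm_sq_eq]
    push_cast
    exact Finset.sum_congr rfl fun a _ => Complex.conj_mul' (x a)
  rw [hV.star_sum_mul_sum, h2, norm_smul, Complex.norm_real, Real.norm_of_nonneg (by positivity)]
    at h1
  have h3 : ‖(1 : A)‖ ≤ 1 := norm_le_one_of_star_mul_self (by simp)
  have h4 : ‖∑ a, x a • V a‖ * ‖∑ a, x a • V a‖ ≤ ‖x‖ ^ 2 := by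
    rw [← h1]; nlinarith [sq_nonneg ‖x‖]
  exact abs_le_of_sq_le_sq' (by nlinarith) (norm_nonneg x) |>.2

/-- The homomorphism is contractive, so the matrix c itself has norm above r and some x in the unit
ball has ‖c x‖ > r. Take y = c x / ‖c x‖; then ⟨y, c x⟩ = ‖c x‖ is the scalar μ. -/
theorem IsCuntzTuple.exists_lt_norm (hV : IsCuntzTuple V) (c : Matrix (Fin n) (Fin n) ℂ) {r : ℝ}
    (hr₀ : 0 ≤ r) (hr : r < ‖hV.matrixHom c‖) :
    ∃ x y : Fin n → ℂ, ‖∑ a, x a • V a‖ ≤ 1 ∧ ‖∑ a, y a • V a‖ ≤ 1 ∧ ∃ μ : ℂ, r < ‖μ‖ ∧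
      star (∑ a, y a • V a) * hV.matrixHom c * ∑ a, x a • V a = μ • 1 := by
  have hc : r < ‖Matrix.toEuclideanCLM (n := Fin n) (𝕜 := ℂ) c‖ :=
    hr.trans_le (NonUnitalStarAlgHom.norm_apply_le hV.matrixHom c)
  obtain ⟨x, hx, hcx⟩ := ContinuousLinearMap.exists_lt_apply_of_lt_opNorm _ hc
  set y := Matrix.toEuclideanCLM (n := Fin n) (𝕜 := ℂ) c x with hy
  have hy0 : 0 < ‖y‖ := hr₀.trans_lt hcx
  have hyc : ∀ a, y a = c.mulVec (fun b => x b) a := fun a => by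
    rw [hy]; exact congrFun (Matrix.ofLp_toEuclideanCLM c x) a
  refine ⟨fun a => x a, fun a => (((‖y‖⁻¹ : ℝ) : ℂ) • y) a,
    (hV.norm_sum_smul_le x).trans hx.le, (hV.norm_sum_smul_le _).trans ?_, ‖y‖, ?_, ?_⟩
  · rw [norm_smul, Complex.norm_real, norm_inv, norm_norm, inv_mul_cancel₀ hy0.ne']
  · rw [Complex.norm_real, norm_norm]
    exact hcx
  · rw [mul_assoc, hV.matrixHom_mul_sum, hV.star_sum_mul_sum]
    congr 1
    have h2 : ∑ a, star (y a) * y a = ((‖y‖ ^ 2 : ℝ) : ℂ) := by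
      rw [EuclideanSpace.norm_sq_eq]
      push_cast
      exact Finset.sum_congr rfl fun a _ => Complex.conj_mul' (y a)
    have h3 : ∀ a, star ((((‖y‖⁻¹ : ℝ) : ℂ) • y) a) * c.mulVec (fun b => x b) a
        = ((‖y‖⁻¹ : ℝ) : ℂ) * (star (y a) * y a) := fun a => by
      rw [← hyc, PiLp.smul_apply, smul_eq_mul, star_mul', mul_assoc]
      congr 1
      exact Complex.conj_ofReal _
    rw [Finset.sum_congr rfl fun a _ => h3 a, ← Finset.mul_sum, h2]
    push_cast
    have : (‖y‖ : ℂ) ≠ 0 := by exact_mod_cast hy0.ne'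
    field_simp

end MatrixHom

namespace SingleVertexGraph

variable {k : ℕ} {D : SingleVertexGraph k}

/-! ### Elements of degree zero as matrices -/

theorem exists_star_wordOp_mul_wordOp (u v : D.Path) (h : D.deg u = D.deg v) :
    ∃ c : ℂ, star (wordOp.{u} D u) * wordOp D v = c • 1 := by
  induction u using path_induction generalizing v with
  | one =>
    induction v using path_induction with
    | one => exact ⟨1, by simp⟩
    | edge_mul i s w ih =>
      have := congrFun h i
      rw [deg_edge_mul_self, deg_one, Pi.zero_apply] at this
      omega
  | edge_mul i s u ih =>
    obtain ⟨t, v, rfl⟩ := exists_eq_edge_mul (w := v) (i := i) (by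
      rw [← h, deg_edge_mul_self]; omega)
    rw [deg_mul, deg_mul, deg_edge, deg_edge, add_right_inj] at h
    obtain ⟨c, hc⟩ := ih v h
    refine ⟨if s = t then c else 0, ?_⟩
    rw [wordOp_edge_mul, wordOp_edge_mul, star_mul, mul_assoc, ← mul_assoc (star (gen D i s)),
      star_gen_mul_gen]
    split_ifs
    · rw [one_mul, hc]
    · rw [zero_mul, mul_zero, zero_smul]

theorem exists_eq_mul_of_deg_eq_add (z u : D.Path) (q : Fin k → ℕ) (h : D.deg u = D.deg z + q) :
    ∃ u₁ u₂, u = u₁ * u₂ ∧ D.deg u₁ = D.deg z ∧ D.deg u₂ = q := by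
  induction z using path_induction generalizing u with
  | one => exact ⟨1, u, (one_mul u).symm, rfl, by rw [h, deg_one, zero_add]⟩
  | edge_mul i s z ih =>
    obtain ⟨t, u, rfl⟩ := exists_eq_edge_mul (w := u) (i := i) (by
      rw [h, Pi.add_apply, deg_edge_mul_self]; omega)
    rw [deg_mul, deg_mul, deg_edge, deg_edge, add_assoc, add_right_inj] at h
    obtain ⟨u₁, u₂, rfl, h1, h2⟩ := ih u h
    exact ⟨D.edge i t * u₁, u₂, (mul_assoc _ _ _).symm, by
      rw [deg_mul, deg_mul, h1, deg_edge, deg_edge], h2⟩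

variable (D) in
/-- All the matrix coefficients of `x` with respect to words of degree `p` are scalars. -/
def HasScalarCoeff (p : Fin k → ℕ) (x : CStarAlg.{u} D) : Prop :=
  ∀ u v : D.Path, D.deg u = p → D.deg v = p →
    ∃ c : ℂ, star (wordOp D u) * x * wordOp D v = c • 1

theorem HasScalarCoeff.mul {z : D.Path} {x : CStarAlg.{u} D} (h : D.HasScalarCoeff (D.deg z) x)
    (z' : D.Path) : D.HasScalarCoeff (D.deg (z * z')) x := by
  intro u v hu hv
  rw [deg_mul] at hu hv
  obtain ⟨u₁, u₂, rfl, hu₁, hu₂⟩ := exists_eq_mul_of_deg_eq_add z u _ hu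
  obtain ⟨v₁, v₂, rfl, hv₁, hv₂⟩ := exists_eq_mul_of_deg_eq_add z v _ hv
  obtain ⟨c, hc⟩ := h u₁ v₁ hu₁ hv₁
  obtain ⟨d, hd⟩ := exists_star_wordOp_mul_wordOp.{u} u₂ v₂ (hu₂.trans hv₂.symm)
  refine ⟨c * d, ?_⟩
  have e : star (wordOp D (u₁ * u₂)) * x * wordOp D (v₁ * v₂)
      = star (wordOp D u₂) * (star (wordOp D u₁) * x * wordOp D v₁) * wordOp D v₂ := by
    simp only [map_mul, star_mul, mul_assoc]
  rw [e, hc, mul_smul_comm, mul_one, smul_mul_assoc, hd, smul_smul]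

theorem exists_hasScalarCoeff {x : CStarAlg.{u} D} (hx : x ∈ algSpectral.{u} D 0) :
    ∃ z : D.Path, D.HasScalarCoeff (D.deg z) x := by
  induction hx using algSpectral_induction with
  | word u v h =>
    refine ⟨u, fun u' v' hu hv => ?_⟩
    obtain ⟨c, hc⟩ := exists_star_wordOp_mul_wordOp.{u} u' u hu
    obtain ⟨d, hd⟩ := exists_star_wordOp_mul_wordOp.{u} v v' (by
      rw [hv]
      funext i
      have := h i
      rw [Pi.zero_apply] at this
      omega)
    exact ⟨c * d, by rw [← mul_assoc, hc, mul_assoc, hd, smul_mul_smul_comm, one_mul]⟩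
  | zero => exact ⟨1, fun u v _ _ => ⟨0, by simp⟩⟩
  | add x y _ _ hx hy =>
    obtain ⟨z, hz⟩ := hx
    obtain ⟨z', hz'⟩ := hy
    -- Scalar coefficients persist in larger degrees, so the two summands can be compared in the
    -- common degree d(z) + d(z').
    refine ⟨z * z', fun u v hu hv => ?_⟩
    obtain ⟨c, hc⟩ := hz.mul z' u v hu hv
    obtain ⟨d, hd⟩ := hz'.mul z u v (by rw [hu, deg_mul, deg_mul, add_comm])
      (by rw [hv, deg_mul, deg_mul, add_comm])
    exact ⟨c + d, by rw [mul_add, add_mul, hc, hd, add_smul]⟩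
  | smul c x _ hx =>
    obtain ⟨z, hz⟩ := hx
    refine ⟨z, fun u v hu hv => ?_⟩
    obtain ⟨d, hd⟩ := hz u v hu hv
    exact ⟨c * d, by rw [mul_smul_comm, smul_mul_assoc, hd, smul_smul]⟩

/-- Multiply x on both sides by ∑ₐ V_a V_a⋆ = 1; the scalar coefficients are the matrix entries. -/
theorem IsWordFamily.exists_eq_matrixHom {p : Fin k → ℕ} {n : ℕ} {V : Fin n → D.Path}
    (hV : IsWordFamily.{u} p V) {x : CStarAlg.{u} D} (hx : D.HasScalarCoeff p x) :
    ∃ c, x = hV.cuntz.matrixHom c := by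
  choose c hc using fun a b => hx (V a) (V b) (hV.deg a) (hV.deg b)
  refine ⟨Matrix.of c, ?_⟩
  have h : x = (∑ a, wordOp D (V a) * star (wordOp D (V a))) * x
      * ∑ b, wordOp D (V b) * star (wordOp D (V b)) := by
    rw [hV.cuntz.2, one_mul, mul_one]
  rw [h, IsCuntzTuple.matrixHom_apply, Finset.sum_mul, Finset.sum_mul]
  refine Finset.sum_congr rfl fun a _ => ?_
  rw [Finset.mul_sum]
  refine Finset.sum_congr rfl fun b _ => ?_
  have e : wordOp D (V a) * star (wordOp D (V a)) * x * (wordOp D (V b) * star (wordOp D (V b)))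
      = wordOp D (V a) * (star (wordOp D (V a)) * x * wordOp D (V b)) * star (wordOp D (V b)) := by
    simp only [mul_assoc]
  rw [e, hc, mul_smul_comm, mul_one, smul_mul_assoc, Matrix.of_apply]

/-- All words in the family have the same degree, so the compression shifts degrees by -p and then
by p. -/
theorem IsWordFamily.star_sum_mul_mul_sum_mem {p : Fin k → ℕ} {n : ℕ} {V : Fin n → D.Path}
    (hV : IsWordFamily.{u} p V) (x y : Fin n → ℂ) {b : CStarAlg.{u} D}
    (hb : b ∈ ⨆ n : {n : Fin k → ℤ // n ≠ 0}, algSpectral.{u} D n) :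
    star (∑ a, y a • wordOp D (V a)) * b * ∑ a, x a • wordOp D (V a)
      ∈ ⨆ n : {n : Fin k → ℤ // n ≠ 0}, algSpectral.{u} D n := by
  have h : ∀ a c, star (wordOp D (V a)) * b * wordOp D (V c)
      ∈ ⨆ n : {n : Fin k → ℤ // n ≠ 0}, algSpectral.{u} D n := by
    intro a c
    induction hb using Submodule.iSup_induction' with
    | mem n b hb =>
      refine Submodule.mem_iSup_of_mem n ?_
      have h1 := wordOp_mul_mem_algSpectral (V c) (one_mem_algSpectral.{u} (D := D))
      rw [mul_one] at h1
      convert mul_mem_algSpectral (star_wordOp_mul_mem_algSpectral (V a) hb) h1 using 2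
      rw [hV.deg, hV.deg, zero_add, sub_add_cancel]
    | zero => rw [mul_zero, zero_mul]; exact zero_mem _
    | add b b' _ _ hb hb' => rw [mul_add, add_mul]; exact add_mem hb hb'
  simp only [star_sum, star_smul, Finset.sum_mul, Finset.mul_sum, smul_mul_assoc, mul_smul_comm]
  exact sum_mem fun c _ => Submodule.smul_mem _ _ (sum_mem fun a _ =>
    Submodule.smul_mem _ _ (h a c))

/-- The combination ∑ x_a V_a need not lie in 𝒜, but after this multiplication the degrees cancel
and the product falls into 𝒳₀. It can then serve as a multiplier of ideals of 𝒜. -/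
theorem IsWordFamily.sum_mul_mul_star_mem {p q : Fin k → ℕ} {n n' l : ℕ} {V : Fin n → D.Path}
    {W : Fin n' → D.Path} {U : Fin l → D.Path} (hV : IsWordFamily.{u} p V)
    (hW : IsWordFamily.{u} q W) (hU : IsWordFamily.{u} (p + q) U) (x : Fin n → ℂ) (d : Fin n')
    (c : Fin l) :
    (∑ a, x a • wordOp D (V a)) * wordOp D (W d) * star (wordOp D (U c)) ∈ algSpectral.{u} D 0 := by
  simp only [Finset.sum_mul, smul_mul_assoc, ← map_mul]
  refine sum_mem fun a _ => Submodule.smul_mem _ _ (wordOp_mul_star_mem fun i => ?_)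
  rw [deg_mul, hV.deg, hW.deg, hU.deg, sub_self]; rfl

/-! ### Simplicity -/

theorem exists_mem_ideal_norm_sub_lt (hm : ∀ i, 1 < D.m i) (hD : D.LittlePullback)
    (𝒜 : StarSubalgebra ℂ (CStarAlg.{u} D)) [IsClosed (𝒜 : Set (CStarAlg.{u} D))]
    (hX : (algSpectral.{u} D 0 : Set (CStarAlg.{u} D)) ⊆ 𝒜) (I : TwoSidedIdeal 𝒜) {a : 𝒜}
    (ha : a ∈ I) (ha₀ : a ≠ 0) : ∃ y ∈ I, ∃ μ : ℂ, ‖y - μ • 1‖ < ‖μ‖ := by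
  set f : CStarAlg.{u} D := star (a : CStarAlg.{u} D) * a with hf
  have hfI : star a * a ∈ I := I.mul_mem_left _ _ ha
  have hδ : 0 < ‖gaugeIntegral D f‖ := norm_pos_iff.2
    (gaugeIntegral_star_mul_self_ne_zero fun h => ha₀ (Subtype.ext h))
  set δ := ‖gaugeIntegral D f‖ with hδ'
  -- With tolerance δ/8 the degree-zero part has norm above 7δ/8, so |μ| > 3δ/4 can be reached. The
  -- two later errors, from this approximation and from averaging b₁, add up to less than δ/4.
  obtain ⟨b, hb, hfb⟩ := exists_mem_iSup_algSpectral_norm_sub_lt f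
    (show 0 < δ / 8 by positivity)
  obtain ⟨b₀, hb₀, b₁, hb₁, rfl⟩ := exists_add_of_mem_iSup_algSpectral hb
  have hb₀' : δ * 3 / 4 < ‖b₀‖ := by
    have h := norm_gaugeIntegral_sub_le f (b₀ + b₁)
    rw [gaugeIntegral_add, gaugeIntegral_of_mem_zero hb₀, gaugeIntegral_of_mem_iSup hb₁, add_zero,
      norm_toProd] at h
    linarith
  obtain ⟨z, hz⟩ := exists_hasScalarCoeff hb₀
  obtain ⟨n, V, hV⟩ := exists_isWordFamily.{u} hm z
  obtain ⟨c, hc⟩ := hV.exists_eq_matrixHom hz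
  obtain ⟨x, y, hx, hy, μ, hμ, hxy⟩ := hV.cuntz.exists_lt_norm c (by positivity) (hc ▸ hb₀')
  rw [← hc] at hxy
  set v := ∑ a, x a • wordOp D (V a) with hv
  set w := ∑ a, y a • wordOp D (V a) with hw
  obtain ⟨T, hT, hTb⟩ := exists_avg_norm_lt_of_mem_algSpectral hm hD
    (hV.star_sum_mul_mul_sum_mem x y hb₁) (show 0 < δ / 8 by positivity)
  rw [← hv, ← hw] at hTb
  have hTf : ‖T (star w * f * v) - μ • 1‖ < ‖μ‖ := by
    have e : T (star w * f * v) - μ • 1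
        = T (star w * (f - (b₀ + b₁)) * v) + T (star w * b₁ * v) := by
      have h1 : T (star w * b₀ * v) = μ • 1 := by
        rw [hxy, map_smul, map_one_of_mem_avgMonoid hm hT]
      simp only [mul_sub, sub_mul, mul_add, add_mul, map_sub, map_add, h1]
      abel
    have h2 : ‖star w * (f - (b₀ + b₁)) * v‖ ≤ ‖f - (b₀ + b₁)‖ := by
      calc ‖star w * (f - (b₀ + b₁)) * v‖ ≤ ‖w‖ * ‖f - (b₀ + b₁)‖ * ‖v‖ := by
            refine (norm_mul_le _ _).trans ?_
            gcongr
            refine (norm_mul_le _ _).trans ?_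
            rw [norm_star]
        _ ≤ 1 * ‖f - (b₀ + b₁)‖ * 1 := by gcongr
        _ = ‖f - (b₀ + b₁)‖ := by ring
    have h3 := norm_le_of_mem_avgMonoid hT (star w * (f - (b₀ + b₁)) * v)
    rw [e]
    refine (norm_add_le _ _).trans_lt ?_
    linarith
  obtain ⟨q, n', W, hW, hTW⟩ := exists_isWordFamily_of_mem_avgMonoid hm hT
  have hU := hV.mul hW
  set U := fun c => V (finProdFinEquiv.symm c).1 * W (finProdFinEquiv.symm c).2
  -- Since w, v and the words W_d are not assumed to be in 𝒜, T (w⋆ f v) is conjugated by the family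
  -- U of degree p + q. The multipliers of f on either side then have degree zero, so Y lies in the
  -- ideal.
  let R : Fin n' → Fin (n * n') → 𝒜 := fun d c =>
    ⟨v * wordOp D (W d) * star (wordOp D (U c)), hX (hV.sum_mul_mul_star_mem hW hU x d c)⟩
  let L : Fin n' → Fin (n * n') → 𝒜 := fun d c =>
    star ⟨w * wordOp D (W d) * star (wordOp D (U c)), hX (hV.sum_mul_mul_star_mem hW hU y d c)⟩
  let Y : 𝒜 := algebraMap ℂ 𝒜 (n' : ℂ)⁻¹ * ∑ c, ∑ d, L d c * (star a * a) * R d c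
  refine ⟨Y, ?_, μ, ?_⟩
  · refine I.mul_mem_left _ _ (sum_mem fun c _ => sum_mem fun d _ => ?_)
    exact I.mul_mem_right _ _ (I.mul_mem_left _ _ hfI)
  · have hY : (Y : CStarAlg.{u} D) = hU.cuntz.endo (T (star w * f * v)) := by
      rw [IsCuntzTuple.endo_apply, hTW]
      simp only [Y, ← Algebra.smul_def, SetLike.val_smul, AddSubmonoidClass.coe_finsetSum,
        mul_smul_comm, smul_mul_assoc, ← Finset.smul_sum, Finset.mul_sum, Finset.sum_mul]
      congr 1
      refine Finset.sum_congr rfl fun c _ => Finset.sum_congr rfl fun d _ => ?_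
      change star (w * wordOp D (W d) * star (wordOp D (U c))) * f
        * (v * wordOp D (W d) * star (wordOp D (U c))) = _
      simp only [star_mul, star_star, mul_assoc]
    refine lt_of_le_of_lt (le_of_eq_of_le ?_ (hU.cuntz.norm_endo_sub_smul_one_le _ μ)) hTf
    rw [← hY]
    rfl

theorem isSimpleRing (hm : ∀ i, 1 < D.m i) (hD : D.LittlePullback)
    (𝒜 : StarSubalgebra ℂ (CStarAlg.{u} D)) [IsClosed (𝒜 : Set (CStarAlg.{u} D))]
    (hX : (algSpectral.{u} D 0 : Set (CStarAlg.{u} D)) ⊆ 𝒜) : IsSimpleRing 𝒜 := by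
  have : Nontrivial (CStarAlg.{u} D) := nontrivial_cstarAlg fun i => (hm i).trans' zero_lt_one
  refine ⟨⟨fun I => or_iff_not_imp_left.2 fun hI => ?_⟩⟩
  obtain ⟨a, ha, ha₀⟩ : ∃ a ∈ I, a ≠ 0 := by
    by_contra! h
    exact hI (le_bot_iff.1 fun a ha => (TwoSidedIdeal.mem_bot _).2 (h a ha))
  obtain ⟨y, hy, μ, hμ⟩ := exists_mem_ideal_norm_sub_lt hm hD 𝒜 hX I ha ha₀
  have hμ₀ : μ ≠ 0 := norm_pos_iff.1 ((norm_nonneg _).trans_lt hμ)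
  -- After rescaling, y is within distance less than 1 of the identity, so the Neumann series
  -- inverts it in the complete algebra 𝒜. The ideal need not be closed.
  have hu : IsUnit (μ⁻¹ • y) := by
    have h : ‖1 - μ⁻¹ • y‖ < 1 := by
      have e : 1 - μ⁻¹ • y = μ⁻¹ • (μ • 1 - y) := by
        rw [smul_sub, smul_smul, inv_mul_cancel₀ hμ₀, one_smul]
      rw [e, norm_smul, norm_inv, norm_sub_rev, inv_mul_lt_iff₀ (norm_pos_iff.2 hμ₀), mul_one]
      exact hμ
    simpa using isUnit_one_sub_of_norm_lt_one h
  obtain ⟨t, ht⟩ := hu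
  have h1 : μ⁻¹ • y ∈ I := by
    rw [Algebra.smul_def]
    exact I.mul_mem_left _ _ hy
  have h2 : (1 : 𝒜) ∈ I := by
    rw [← t.inv_mul, ht]
    exact I.mul_mem_left _ _ h1
  exact eq_top_iff.2 fun x _ => by simpa using I.mul_mem_left x 1 h2

end SingleVertexGraph

theorem mainTheorem5 {k : ℕ} (D : SingleVertexGraph k) (hm : ∀ i, 1 < D.m i)
    (hD : D.LittlePullback)
    (𝒜 : StarSubalgebra ℂ (SingleVertexGraph.CStarAlg.{u} D))
    [IsClosed (𝒜 : Set (SingleVertexGraph.CStarAlg.{u} D))]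
    (hX : (SingleVertexGraph.algSpectral.{u} D 0 : Set (SingleVertexGraph.CStarAlg.{u} D)) ⊆ 𝒜) :
    IsSimpleRing 𝒜 ∧ HasDixmierProperty 𝒜 :=
  ⟨SingleVertexGraph.isSimpleRing hm hD 𝒜 hX, SingleVertexGraph.hasDixmierProperty hm hD 𝒜 hX⟩
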